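/- **Theorem (upper bounds for the cut time of spacelike normal extremals).** Let the Engel group be $\mathbb R^4$ with coordinates $q=(x_1,x_2,y,z)$ and the left-invariant fields $$X_1=\partial_{x_1}-\tfrac{x_2}{2}\partial_y,\qquad X_2=\partial_{x_2}+\tfrac{x_1}{2}\partial_y+\tfrac{x_1^2+x_2^2}{2}\partial_z,\qquad X_3=\partial_y+x_1\partial_z,\qquad X_4=\partial_z,$$ and let $D=\mathrm{span}\{X_1,X_2\}$ carry the Lorentzian metric $g(X_1,X_1)=-1$, $g(X_2,X_2)=1$, $g(X_1,X_2)=0$. Put $h_i=\langle\xi,X_i\rangle$ and $H=\tfrac12(-h_1^2+h_2^2)$ on the cotangent bundle. For $\lambda=(\theta,c,\alpha)\in\mathbb R^3$ let $t\mapsto\mathrm{Exp}(\lambda,t)$ be the projection to $\mathbb R^4$ of the solution of the Hamiltonian system of $H$ that starts over the origin with $(h_1,h_2,h_3,h_4)=(\sinh\theta,\cosh\theta,c,\alpha)$; these are the spacelike normal extremal trajectories with $H=\frac12$, $h_2>0$. A future directed spacelike curve is an absolutely continuous curve $\gamma$ with $\dot\gamma\in D$, $g(\dot\gamma,\dot\gamma)>0$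 and $g(\dot\gamma,X_2)>0$ almost everywhere. Its length on $[0,t]$ is $\int_0^t|g(\dot\gamma,\dot\gamma)|^{1/2}ds$. It is optimal on $[0,t]$ if no future directed spacelike curve on $[0,t]$ with the same endpoints is longer. The cut time is $$t_{\rm cut}(\lambda)=\sup\{t>0 \mid s\mapsto \mathrm{Exp}(\lambda,s)\text{ is defined and optimal on }[0,t]\}\in[0,+\infty].$$ Let $E=\frac{c^2}{2}-\alpha\cosh\theta$ and $$C_1=\{\alpha<0,\ E>-\alpha\},\qquad C_2=\{\alpha>0,\ E<-\alpha\},\qquad C_3=\{\alpha>0,\ E>-\alpha\}.$$ For a parameter $k^2\in(-\infty,1)$ let $K(k)=\int_0^{\pi/2}(1-k^2\sin^2 s)^{-1/2}ds$, and let $\mathrm{sn},\mathrm{cn},\mathrm{dn}$ be the Jacobi functions with parameter $k^2$. 1. If $\lambda\in C_1$, then with $k^2=\frac{E+\alpha}{E-\alpha}$ and $\ae=\sqrt{\frac{E-\alpha}{2}}$, $$t_{\rm cut}(\lambda)\le \frac{4K(k)}{\ae}.$$ 2. If $\lambda\in C_2$, put $k^2=\frac{2\alpha}{\alpha-E}$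 and $\ae=\sqrt{\frac{\alpha-E}{2}}$. There is exactly one $\varphi_0\in(-K(k)/\ae,K(k)/\ae)$ such that, with $\psi_0=\ae\varphi_0$, $$c=-\operatorname{sgn}\theta\,\sqrt{2(-\alpha-E)}\,\frac{\mathrm{sn}\,\psi_0}{\mathrm{cn}\,\psi_0},\qquad \sinh\theta=\operatorname{sgn}\theta\,\frac{\sqrt{-\alpha-E}\,\sqrt{\alpha-E}\;\mathrm{dn}\,\psi_0}{\alpha\,\mathrm{cn}^2\psi_0},$$ and for it $$t_{\rm cut}(\lambda)\le\frac{K(k)-\psi_0}{\ae}.$$ 3. If $\lambda\in C_3$, put $k^2=\frac{E-\alpha}{E+\alpha}$ (which may be negative) and $\ae=\sqrt{\frac{E+\alpha}{2}}$. There is exactly one $\varphi_0\in(-K(k)/\ae,K(k)/\ae)$ such that, with $\psi_0=\ae\varphi_0$, $$c=\operatorname{sgn}c\,\frac{2\ae\,\mathrm{dn}\,\psi_0}{\mathrm{cn}\,\psi_0},\qquad \sinh\theta=-\operatorname{sgn}c\,\frac{2\,\mathrm{sn}\,\psi_0}{\mathrm{cn}^2\psi_0},$$ and for it $$t_{\rm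 cut}(\lambda)\le\frac{K(k)-\psi_0}{\ae}.$$ -/

import Mathlib

open MeasureTheory Set
open scoped ENNReal

noncomputable section

namespace Engel

/-- Points, tangent vectors and covectors of the Engel group `ℝ⁴`, in the coordinates
`(x₁, x₂, y, z)`, which are indexed by `0, 1, 2, 3`. -/
abbrev Vec4 : Type := Fin 4 → ℝ

/-- The left-invariant field `X₁ = ∂/∂x₁ - (x₂/2) ∂/∂y`. -/
def X1 (q : Vec4) : Vec4 := ![1, 0, -(q 1) / 2, 0]

/-- The left-invariant field `X₂ = ∂/∂x₂ + (x₁/2) ∂/∂y + ((x₁² + x₂²)/2) ∂/∂z`. -/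
def X2 (q : Vec4) : Vec4 := ![0, 1, q 0 / 2, ((q 0) ^ 2 + (q 1) ^ 2) / 2]

/-- The Lorentzian metric on `D = span {X₁, X₂}` with `g(X₁, X₁) = -1`, `g(X₂, X₂) = 1`,
`g(X₁, X₂) = 0`. The first two coordinates of `u₁ X₁ + u₂ X₂` are `u₁` and `u₂`, so on `D` the
metric is the following expression at every point. -/
def metric (v w : Vec4) : ℝ := -(v 0 * w 0) + v 1 * w 1

/-- The sub-Lorentzian Hamiltonian `H = (-⟨ξ, X₁⟩² + ⟨ξ, X₂⟩²) / 2` on the cotangent bundle. -/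
def hamiltonian (q ξ : Vec4) : ℝ := (-(ξ ⬝ᵥ X1 q) ^ 2 + (ξ ⬝ᵥ X2 q) ^ 2) / 2

/-- An initial covector `(θ, c, α)` in the set `C = T*₀ ∩ {H = 1/2, h₂ > 0}`. -/
structure Covector where
  θ : ℝ
  c : ℝ
  α : ℝ

namespace Covector

/-- The covector at the origin: `(h₁, h₂, h₃, h₄) = (sinh θ, cosh θ, c, α)`. At the origin the
frame `X₁, X₂, X₃, X₄` is the coordinate frame, so these are also its coordinates. -/
def toVec (l : Covector) : Vec4 := ![Real.sinh l.θ, Real.cosh l.θ, l.c, l.α]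

/-- The energy integral `E = c²/2 - α cosh θ`. -/
def E (l : Covector) : ℝ := l.c ^ 2 / 2 - l.α * Real.cosh l.θ

end Covector

/-- `C₁ = {α < 0, E > -α}`. -/
def C1 : Set Covector := {l | l.α < 0 ∧ -l.α < l.E}

/-- `C₂ = {α > 0, E < -α}`. -/
def C2 : Set Covector := {l | 0 < l.α ∧ l.E < -l.α}

/-- `C₃ = {α > 0, E > -α}`. -/
def C3 : Set Covector := {l | 0 < l.α ∧ -l.α < l.E}

/-- `(q, ξ)` solves the Hamiltonian system of `H` on `[0, T]`, starts at the origin of the group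
and has the initial covector `l`. -/
structure IsNormalExtremal (l : Covector) (T : ℝ) (q ξ : ℝ → Vec4) : Prop where
  init_q : q 0 = 0
  init_ξ : ξ 0 = l.toVec
  deriv_q : ∀ t ∈ Icc 0 T, ∀ i : Fin 4, HasDerivWithinAt (fun s => q s i)
    (lineDeriv ℝ (fun p => hamiltonian (q t) p) (ξ t) (Pi.single i 1)) (Icc 0 T) t
  deriv_ξ : ∀ t ∈ Icc 0 T, ∀ i : Fin 4, HasDerivWithinAt (fun s => ξ s i)
    (-lineDeriv ℝ (fun x => hamiltonian x (ξ t)) (q t) (Pi.single i 1)) (Icc 0 T) t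

/-- `γ` is, on `[0, T]`, an absolutely continuous horizontal curve that is spacelike and future
directed with respect to `X₂`: for almost every `t` its velocity is a vector `v` of `D` with
`g(v, v) > 0` and `g(v, X₂) > 0`. -/
structure IsSpacelikeFD (T : ℝ) (γ : ℝ → Vec4) : Prop where
  absCont : AbsolutelyContinuousOnInterval γ 0 T
  velocity : ∀ᵐ t ∂(volume.restrict (Icc 0 T)), ∃ u₁ u₂ : ℝ,
    let v := u₁ • X1 (γ t) + u₂ • X2 (γ t)
    HasDerivAt γ v t ∧ 0 < metric v v ∧ 0 < metric v (X2 (γ t))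

/-- The sub-Lorentzian length `∫₀ᵀ |g(γ', γ')|^{1/2} dt`. -/
def length (T : ℝ) (γ : ℝ → Vec4) : ℝ :=
  ∫ t in (0 : ℝ)..T, Real.sqrt |metric (deriv γ t) (deriv γ t)|

/-- `γ` is optimal on `[0, T]`: it is longest among the future directed spacelike curves with the
same endpoints. -/
def IsOptimal (T : ℝ) (γ : ℝ → Vec4) : Prop :=
  IsSpacelikeFD T γ ∧
    ∀ η : ℝ → Vec4, IsSpacelikeFD T η → η 0 = γ 0 → η T = γ T → length T η ≤ length T γ

/-- The cut time of `l`: the supremum of the times `t > 0` such that the normal extremal trajectory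
with initial covector `l` exists and is optimal on `[0, t]`. -/
def cutTime (l : Covector) : ℝ≥0∞ :=
  sSup {τ | ∃ t : ℝ, 0 < t ∧ τ = ENNReal.ofReal t ∧
    ∃ q ξ : ℝ → Vec4, IsNormalExtremal l t q ξ ∧ IsOptimal t q}

/-! Elliptic integrals and Jacobi functions with parameter `m = k² ∈ (-∞, 1)`. -/

/-- `F(φ) = ∫₀^φ ds / (1 - m sin² s)^{1/2}`. -/
def ellipticF (m φ : ℝ) : ℝ := ∫ s in (0 : ℝ)..φ, 1 / Real.sqrt (1 - m * Real.sin s ^ 2)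

/-- The complete elliptic integral of the first kind. -/
def ellipticK (m : ℝ) : ℝ := ellipticF m (Real.pi / 2)

/-- The Jacobi amplitude: the inverse of `F`, which is a bijection of `ℝ` for `m < 1`. -/
def am (m u : ℝ) : ℝ := Function.invFun (ellipticF m) u

def sn (m u : ℝ) : ℝ := Real.sin (am m u)

def cn (m u : ℝ) : ℝ := Real.cos (am m u)

def dn (m u : ℝ) : ℝ := Real.sqrt (1 - m * sn m u ^ 2)

namespace Covector

/-! The parameter `m = k²` and the constant `æ` in the domains `C₁`, `C₂`, `C₃`. -/

def m1 (l : Covector) : ℝ := (l.E + l.α) / (l.E - l.α)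

def ae1 (l : Covector) : ℝ := Real.sqrt ((l.E - l.α) / 2)

def m2 (l : Covector) : ℝ := 2 * l.α / (l.α - l.E)

def ae2 (l : Covector) : ℝ := Real.sqrt ((l.α - l.E) / 2)

def m3 (l : Covector) : ℝ := (l.E - l.α) / (l.E + l.α)

def ae3 (l : Covector) : ℝ := Real.sqrt ((l.E + l.α) / 2)

/-- `φ` is the rectifying coordinate of `l` in the domain `C₂`; along the extremals `φ` grows with
unit speed. -/
def IsPhase2 (l : Covector) (φ : ℝ) : Prop :=
  φ ∈ Ioo (-(ellipticK l.m2 / l.ae2)) (ellipticK l.m2 / l.ae2) ∧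
  l.c = -(Real.sign l.θ) * Real.sqrt (2 * (-l.α - l.E)) *
    sn l.m2 (l.ae2 * φ) / cn l.m2 (l.ae2 * φ) ∧
  Real.sinh l.θ = Real.sign l.θ * (Real.sqrt (-l.α - l.E) * Real.sqrt (l.α - l.E)) *
    dn l.m2 (l.ae2 * φ) / (l.α * cn l.m2 (l.ae2 * φ) ^ 2)

/-- `φ` is the rectifying coordinate of `l` in the domain `C₃`; along the extremals `φ` grows with
unit speed. -/
def IsPhase3 (l : Covector) (φ : ℝ) : Prop :=
  φ ∈ Ioo (-(ellipticK l.m3 / l.ae3)) (ellipticK l.m3 / l.ae3) ∧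
  l.c = Real.sign l.c * (2 * l.ae3 * dn l.m3 (l.ae3 * φ)) / cn l.m3 (l.ae3 * φ) ∧
  Real.sinh l.θ = -(Real.sign l.c) * (2 * sn l.m3 (l.ae3 * φ)) / cn l.m3 (l.ae3 * φ) ^ 2

end Covector

end Engel

end

open MeasureTheory Set
open scoped ENNReal

noncomputable section

namespace Engel

/-- The function `(1 - m sin² φ)^{1/2}`. -/
def delta (m φ : ℝ) : ℝ := Real.sqrt (1 - m * Real.sin φ ^ 2)

theorem one_sub_mul_sin_sq_pos {m : ℝ} (hm : m < 1) (φ : ℝ) : 0 < 1 - m * Real.sin φ ^ 2 := by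
  have h1 := Real.sin_sq_le_one φ
  have h2 := sq_nonneg (Real.sin φ)
  rcases le_or_gt m 0 with h | h
  · nlinarith [mul_nonneg (neg_nonneg.2 h) h2]
  · nlinarith [mul_le_mul_of_nonneg_left h1 h.le]

theorem delta_pos {m : ℝ} (hm : m < 1) (φ : ℝ) : 0 < delta m φ :=
  Real.sqrt_pos.2 (one_sub_mul_sin_sq_pos hm φ)

theorem delta_sq {m : ℝ} (hm : m < 1) (φ : ℝ) : delta m φ ^ 2 = 1 - m * Real.sin φ ^ 2 :=
  Real.sq_sqrt (one_sub_mul_sin_sq_pos hm φ).le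

theorem delta_le (m φ : ℝ) : delta m φ ≤ Real.sqrt (1 + |m|) := by
  refine Real.sqrt_le_sqrt ?_
  have h1 := Real.sin_sq_le_one φ
  have h2 := sq_nonneg (Real.sin φ)
  have h3 := neg_abs_le m
  have h4 := abs_nonneg m
  nlinarith

theorem delta_neg (m φ : ℝ) : delta m (-φ) = delta m φ := by simp [delta]

theorem delta_add_pi (m φ : ℝ) : delta m (φ + Real.pi) = delta m φ := by simp [delta]

theorem continuous_delta (m : ℝ) : Continuous (delta m) := by
  unfold delta; fun_prop

theorem hasDerivAt_delta {m : ℝ} (hm : m < 1) (φ : ℝ) :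
    HasDerivAt (delta m) (-(m * Real.sin φ * Real.cos φ) / delta m φ) φ := by
  have h := (((Real.hasDerivAt_sin φ).pow 2).const_mul m).const_sub 1
  have h2 := h.sqrt (one_sub_mul_sin_sq_pos hm φ).ne'
  refine h2.congr_deriv ?_
  have := (delta_pos hm φ).ne'
  change _ / (2 * delta m φ) = _
  field_simp
  norm_num
  ring

theorem ellipticF_eq (m φ : ℝ) : ellipticF m φ = ∫ s in (0 : ℝ)..φ, (delta m s)⁻¹ := by
  simp [ellipticF, delta]

theorem hasDerivAt_ellipticF {m : ℝ} (hm : m < 1) (φ : ℝ) :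
    HasDerivAt (ellipticF m) (delta m φ)⁻¹ φ := by
  have hc : Continuous fun s => (delta m s)⁻¹ :=
    (continuous_delta m).inv₀ fun s => (delta_pos hm s).ne'
  have h : ellipticF m = fun φ => ∫ s in (0 : ℝ)..φ, (delta m s)⁻¹ := funext (ellipticF_eq m)
  rw [h]
  exact hc.integral_hasStrictDerivAt 0 φ |>.hasDerivAt

theorem ellipticF_zero (m : ℝ) : ellipticF m 0 = 0 := by simp [ellipticF]

theorem continuous_ellipticF {m : ℝ} (hm : m < 1) : Continuous (ellipticF m) :=
  continuous_iff_continuousAt.2 fun φ => (hasDerivAt_ellipticF hm φ).continuousAt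

theorem strictMono_ellipticF {m : ℝ} (hm : m < 1) : StrictMono (ellipticF m) :=
  strictMono_of_deriv_pos fun φ => by
    rw [(hasDerivAt_ellipticF hm φ).deriv]; exact inv_pos.2 (delta_pos hm φ)

theorem ellipticF_neg (m φ : ℝ) : ellipticF m (-φ) = -ellipticF m φ := by
  rw [ellipticF_eq, ellipticF_eq, ← intervalIntegral.integral_symm, ← neg_zero,
    ← intervalIntegral.integral_comp_neg]
  simp [delta_neg]

theorem ellipticF_add_pi {m : ℝ} (hm : m < 1) (φ : ℝ) :
    ellipticF m (φ + Real.pi) = ellipticF m φ + 2 * ellipticK m := by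
  have hd : ∀ x, HasDerivAt (fun y => ellipticF m (y + Real.pi) - ellipticF m y) 0 x := by
    intro x
    have h := ((hasDerivAt_ellipticF hm (x + Real.pi)).comp_add_const x Real.pi).sub
      (hasDerivAt_ellipticF hm x)
    rwa [delta_add_pi, sub_self] at h
  have hconst := is_const_of_deriv_eq_zero (fun x => (hd x).differentiableAt)
    (fun x => (hd x).deriv) φ (-(Real.pi / 2))
  have h2 : -(Real.pi / 2) + Real.pi = Real.pi / 2 := by ring
  simp only [h2, ellipticF_neg] at hconst
  unfold ellipticK
  linarith

theorem surjective_ellipticF {m : ℝ} (hm : m < 1) : Function.Surjective (ellipticF m) := by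
  set C := Real.sqrt (1 + |m|)
  have hC : 0 < C := Real.sqrt_pos.2 (by positivity)
  have hmono : Monotone fun φ => ellipticF m φ - C⁻¹ * φ := by
    have hd : ∀ x, HasDerivAt (fun φ => ellipticF m φ - C⁻¹ * φ) ((delta m x)⁻¹ - C⁻¹ * 1) x :=
      fun x => (hasDerivAt_ellipticF hm x).sub ((hasDerivAt_id x).const_mul _)
    refine monotone_of_deriv_nonneg (fun x => (hd x).differentiableAt) fun x => ?_
    rw [(hd x).deriv, mul_one, sub_nonneg]
    exact inv_anti₀ (delta_pos hm x) (delta_le m x)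
  refine (continuous_ellipticF hm).surjective ?_ ?_
  · refine Filter.tendsto_atTop_mono' _ ?_ (Filter.tendsto_id.const_mul_atTop (inv_pos.2 hC))
    filter_upwards [Filter.eventually_ge_atTop 0] with x hx
    have := hmono hx
    simp only [ellipticF_zero, id] at this ⊢
    linarith
  · refine Filter.tendsto_atBot_mono' _ ?_ (Filter.tendsto_id.const_mul_atBot (inv_pos.2 hC))
    filter_upwards [Filter.eventually_le_atBot 0] with x hx
    have := hmono hx
    simp only [ellipticF_zero, id] at this ⊢
    linarith

theorem am_ellipticF {m : ℝ} (hm : m < 1) (φ : ℝ) : am m (ellipticF m φ) = φ :=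
  Function.leftInverse_invFun (strictMono_ellipticF hm).injective φ

theorem ellipticF_am {m : ℝ} (hm : m < 1) (u : ℝ) : ellipticF m (am m u) = u :=
  Function.rightInverse_invFun (surjective_ellipticF hm) u

theorem strictMono_am {m : ℝ} (hm : m < 1) : StrictMono (am m) := fun u v h => by
  rwa [← (strictMono_ellipticF hm).lt_iff_lt, ellipticF_am hm, ellipticF_am hm]

theorem continuous_am {m : ℝ} (hm : m < 1) : Continuous (am m) :=
  (strictMono_am hm).monotone.continuous_of_surjective fun φ => ⟨_, am_ellipticF hm φ⟩

theorem hasDerivAt_am {m : ℝ} (hm : m < 1) (u : ℝ) :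
    HasDerivAt (am m) (delta m (am m u)) u := by
  have h := HasDerivAt.of_local_left_inverse (continuous_am hm).continuousAt
    (hasDerivAt_ellipticF hm (am m u)) (inv_ne_zero (delta_pos hm _).ne')
    (Filter.Eventually.of_forall (ellipticF_am hm))
  rwa [inv_inv] at h

theorem am_ellipticK {m : ℝ} (hm : m < 1) : am m (ellipticK m) = Real.pi / 2 :=
  am_ellipticF hm _

theorem am_neg {m : ℝ} (hm : m < 1) (u : ℝ) : am m (-u) = -am m u := by
  rw [← am_ellipticF hm (-am m u), ellipticF_neg, ellipticF_am hm]

theorem am_add_two_mul_ellipticK {m : ℝ} (hm : m < 1) (u : ℝ) :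
    am m (u + 2 * ellipticK m) = am m u + Real.pi := by
  rw [← am_ellipticF hm (am m u + Real.pi), ellipticF_add_pi hm, ellipticF_am hm]

theorem am_add_four_mul_ellipticK {m : ℝ} (hm : m < 1) (u : ℝ) :
    am m (u + 4 * ellipticK m) = am m u + 2 * Real.pi := by
  have : u + 4 * ellipticK m = u + 2 * ellipticK m + 2 * ellipticK m := by ring
  rw [this, am_add_two_mul_ellipticK hm, am_add_two_mul_ellipticK hm]
  ring

theorem ellipticK_pos {m : ℝ} (hm : m < 1) : 0 < ellipticK m := by
  have := strictMono_ellipticF hm (Real.pi_div_two_pos)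
  rwa [ellipticF_zero] at this

theorem am_mem_Ioo_iff {m : ℝ} (hm : m < 1) (u : ℝ) :
    am m u ∈ Ioo (-(Real.pi / 2)) (Real.pi / 2) ↔ u ∈ Ioo (-ellipticK m) (ellipticK m) := by
  rw [← am_ellipticK hm, ← am_neg hm, mem_Ioo, mem_Ioo, (strictMono_am hm).lt_iff_lt,
    (strictMono_am hm).lt_iff_lt]

theorem dn_eq (m u : ℝ) : dn m u = delta m (am m u) := rfl

/-- Two solutions on an interval of an autonomous differential equation with a `C¹` right-hand side
agree if they agree at the left end. -/
theorem eqOn_of_hasDerivWithinAt_of_contDiff {E : Type*} [NormedAddCommGroup E] [NormedSpace ℝ E]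
    {F : E → E} (hF : ContDiff ℝ 1 F) {f g : ℝ → E} {a b : ℝ}
    (hf : ∀ t ∈ Icc a b, HasDerivWithinAt f (F (f t)) (Icc a b) t)
    (hg : ∀ t ∈ Icc a b, HasDerivWithinAt g (F (g t)) (Icc a b) t) (h : f a = g a) :
    EqOn f g (Icc a b) := by
  have hfc : ContinuousOn f (Icc a b) := fun t ht => (hf t ht).continuousWithinAt
  have hgc : ContinuousOn g (Icc a b) := fun t ht => (hg t ht).continuousWithinAt
  obtain ⟨K, hK⟩ := hF.locallyLipschitz.locallyLipschitzOn.exists_lipschitzOnWith_of_compact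
    ((isCompact_Icc.image_of_continuousOn hfc).union (isCompact_Icc.image_of_continuousOn hgc))
  have hnhds : ∀ t ∈ Ico a b, Icc a b ∈ nhdsWithin t (Ici t) := fun t ht =>
    Filter.mem_of_superset (Icc_mem_nhdsGE ht.2) (Icc_subset_Icc_left ht.1)
  refine ODE_solution_unique_of_mem_Icc_right (v := fun _ => F) (fun t _ => hK) hfc
    (fun t ht => (hf t (Ico_subset_Icc_self ht)).mono_of_mem_nhdsWithin (hnhds t ht))
    (fun t ht => Or.inl (mem_image_of_mem _ (Ico_subset_Icc_self ht))) hgc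
    (fun t ht => (hg t (Ico_subset_Icc_self ht)).mono_of_mem_nhdsWithin (hnhds t ht))
    (fun t ht => Or.inr (mem_image_of_mem _ (Ico_subset_Icc_self ht))) h

/-- `(h₁, h₂, h₃)` solves, on `[0, T]`, the vertical part of the Hamiltonian system of a normal
extremal with `h₄ = α`. -/
structure IsVertical (α T : ℝ) (h₁ h₂ h₃ : ℝ → ℝ) : Prop where
  deriv₁ : ∀ t ∈ Icc 0 T, HasDerivWithinAt h₁ (-(h₂ t * h₃ t)) (Icc 0 T) t
  deriv₂ : ∀ t ∈ Icc 0 T, HasDerivWithinAt h₂ (-(h₁ t * h₃ t)) (Icc 0 T) t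
  deriv₃ : ∀ t ∈ Icc 0 T, HasDerivWithinAt h₃ (-(α * h₁ t)) (Icc 0 T) t

theorem IsVertical.mono {α T S : ℝ} {h₁ h₂ h₃ : ℝ → ℝ} (h : IsVertical α T h₁ h₂ h₃)
    (hS : S ≤ T) : IsVertical α S h₁ h₂ h₃ := by
  have hs : Icc 0 S ⊆ Icc 0 T := Icc_subset_Icc_right hS
  exact ⟨fun t ht => (h.deriv₁ t (hs ht)).mono hs, fun t ht => (h.deriv₂ t (hs ht)).mono hs,
    fun t ht => (h.deriv₃ t (hs ht)).mono hs⟩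

theorem IsVertical.eqOn {α T : ℝ} {h₁ h₂ h₃ k₁ k₂ k₃ : ℝ → ℝ} (h : IsVertical α T h₁ h₂ h₃)
    (k : IsVertical α T k₁ k₂ k₃) (e₁ : h₁ 0 = k₁ 0) (e₂ : h₂ 0 = k₂ 0) (e₃ : h₃ 0 = k₃ 0)
    {t : ℝ} (ht : t ∈ Icc 0 T) : h₁ t = k₁ t ∧ h₂ t = k₂ t ∧ h₃ t = k₃ t := by
  have hF : ContDiff ℝ 1 fun p : ℝ × ℝ × ℝ =>
      ((-(p.2.1 * p.2.2), -(p.1 * p.2.2), -(α * p.1)) : ℝ × ℝ × ℝ) := by fun_prop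
  have := eqOn_of_hasDerivWithinAt_of_contDiff hF
    (f := fun t => (h₁ t, h₂ t, h₃ t)) (g := fun t => (k₁ t, k₂ t, k₃ t)) (a := 0) (b := T)
    (fun t ht => (h.deriv₁ t ht).prodMk ((h.deriv₂ t ht).prodMk (h.deriv₃ t ht)))
    (fun t ht => (k.deriv₁ t ht).prodMk ((k.deriv₂ t ht).prodMk (k.deriv₃ t ht)))
    (by simp only [e₁, e₂, e₃]) ht
  simpa only [Prod.mk.injEq] using this

theorem dotProduct_X1 (ξ q : Vec4) : ξ ⬝ᵥ X1 q = ξ 0 - ξ 2 * q 1 / 2 := by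
  simp [dotProduct, Fin.sum_univ_four, X1]; ring

theorem dotProduct_X2 (ξ q : Vec4) :
    ξ ⬝ᵥ X2 q = ξ 1 + ξ 2 * q 0 / 2 + ξ 3 * (q 0 ^ 2 + q 1 ^ 2) / 2 := by
  simp [dotProduct, Fin.sum_univ_four, X2]; ring

theorem lineDeriv_hamiltonian_right (q ξ b : Vec4) :
    lineDeriv ℝ (fun p => hamiltonian q p) ξ b =
      -(ξ ⬝ᵥ X1 q) * (b ⬝ᵥ X1 q) + (ξ ⬝ᵥ X2 q) * (b ⬝ᵥ X2 q) := by
  have h1 : HasDerivAt (fun t : ℝ => (ξ + t • b) ⬝ᵥ X1 q) (b ⬝ᵥ X1 q) 0 := by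
    simp only [add_dotProduct, smul_dotProduct, smul_eq_mul]
    simpa using ((hasDerivAt_id (0 : ℝ)).mul_const (b ⬝ᵥ X1 q)).const_add (ξ ⬝ᵥ X1 q)
  have h2 : HasDerivAt (fun t : ℝ => (ξ + t • b) ⬝ᵥ X2 q) (b ⬝ᵥ X2 q) 0 := by
    simp only [add_dotProduct, smul_dotProduct, smul_eq_mul]
    simpa using ((hasDerivAt_id (0 : ℝ)).mul_const (b ⬝ᵥ X2 q)).const_add (ξ ⬝ᵥ X2 q)
  have h := ((h1.pow 2).neg.add (h2.pow 2)).div_const 2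
  refine (h.deriv : _ = _).trans ?_
  simp only [zero_smul, add_zero]
  norm_num
  ring

theorem lineDeriv_hamiltonian_left (q ξ b : Vec4) :
    lineDeriv ℝ (fun x => hamiltonian x ξ) q b =
      -(ξ ⬝ᵥ X1 q) * (-(ξ 2 * b 1) / 2) +
        (ξ ⬝ᵥ X2 q) * (ξ 2 * b 0 / 2 + ξ 3 * (q 0 * b 0 + q 1 * b 1)) := by
  have hq : ∀ i, HasDerivAt (fun t : ℝ => (q + t • b) i) (b i) 0 := fun i => by
    simpa using ((hasDerivAt_id (0 : ℝ)).mul_const (b i)).const_add (q i)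
  have h1 : HasDerivAt (fun t : ℝ => ξ ⬝ᵥ X1 (q + t • b)) (-(ξ 2 * b 1) / 2) 0 := by
    simp only [dotProduct_X1]
    exact ((((hq 1).const_mul (ξ 2)).div_const 2).const_sub (ξ 0)).congr_deriv (by ring)
  have h2 : HasDerivAt (fun t : ℝ => ξ ⬝ᵥ X2 (q + t • b))
      (ξ 2 * b 0 / 2 + ξ 3 * (q 0 * b 0 + q 1 * b 1)) 0 := by
    simp only [dotProduct_X2]
    refine (((((hq 0).const_mul (ξ 2)).div_const 2).const_add (ξ 1)).add
      (((((hq 0).pow 2).add ((hq 1).pow 2)).const_mul (ξ 3)).div_const 2)).congr_deriv ?_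
    simp only [zero_smul, add_zero]
    norm_num
    ring
  have h := ((h1.pow 2).neg.add (h2.pow 2)).div_const 2
  refine (h.deriv : _ = _).trans ?_
  simp only [zero_smul, add_zero]
  norm_num
  ring

theorem single_dotProduct_field (v : Vec4) (i : Fin 4) : (Pi.single i 1 : Vec4) ⬝ᵥ v = v i := by
  simp

theorem IsNormalExtremal.hasDerivWithinAt_q {l : Covector} {T : ℝ} {q ξ : ℝ → Vec4}
    (h : IsNormalExtremal l T q ξ) {t : ℝ} (ht : t ∈ Icc 0 T) (i : Fin 4) :
    HasDerivWithinAt (fun s => q s i)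
      (-(ξ t ⬝ᵥ X1 (q t)) * X1 (q t) i + (ξ t ⬝ᵥ X2 (q t)) * X2 (q t) i) (Icc 0 T) t := by
  have := h.deriv_q t ht i
  rwa [lineDeriv_hamiltonian_right, single_dotProduct_field, single_dotProduct_field] at this

theorem IsNormalExtremal.ξ_two_three {l : Covector} {T : ℝ} {q ξ : ℝ → Vec4}
    (h : IsNormalExtremal l T q ξ) {t : ℝ} (ht : t ∈ Icc 0 T) : ξ t 2 = l.c ∧ ξ t 3 = l.α := by
  have key : ∀ i : Fin 4, i ≠ 0 → i ≠ 1 → ξ t i = ξ 0 i := by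
    intro i hi0 hi1
    refine constant_of_derivWithin_zero (f := fun s => ξ s i)
      (fun s hs => (h.deriv_ξ s hs i).differentiableWithinAt) (fun s hs => ?_) t ht
    rw [(h.deriv_ξ s (Ico_subset_Icc_self hs) i).derivWithin
      (uniqueDiffOn_Icc (hs.1.trans_lt hs.2) s (Ico_subset_Icc_self hs)),
      lineDeriv_hamiltonian_left]
    simp [hi0.symm, hi1.symm]
  rw [key 2 (by decide) (by decide), key 3 (by decide) (by decide), h.init_ξ]
  simp [Covector.toVec]

theorem IsNormalExtremal.isVertical {l : Covector} {T : ℝ} {q ξ : ℝ → Vec4}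
    (h : IsNormalExtremal l T q ξ) :
    IsVertical l.α T (fun t => ξ t ⬝ᵥ X1 (q t)) (fun t => ξ t ⬝ᵥ X2 (q t))
      (fun t => l.c + l.α * q t 0) := by
  have hq0 : ∀ t ∈ Icc 0 T, HasDerivWithinAt (fun s => q s 0) (-(ξ t ⬝ᵥ X1 (q t))) (Icc 0 T) t :=
    fun t ht => (h.hasDerivWithinAt_q ht 0).congr_deriv (by simp [X1, X2])
  have hq1 : ∀ t ∈ Icc 0 T, HasDerivWithinAt (fun s => q s 1) (ξ t ⬝ᵥ X2 (q t)) (Icc 0 T) t :=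
    fun t ht => (h.hasDerivWithinAt_q ht 1).congr_deriv (by simp [X1, X2])
  have hξ : ∀ t ∈ Icc 0 T, ∀ i, HasDerivWithinAt (fun s => ξ s i) (-(-(ξ t ⬝ᵥ X1 (q t)) *
      (-(ξ t 2 * (Pi.single i 1 : Vec4) 1) / 2) + (ξ t ⬝ᵥ X2 (q t)) *
      (ξ t 2 * (Pi.single i 1 : Vec4) 0 / 2 + ξ t 3 * (q t 0 * (Pi.single i 1 : Vec4) 0 +
        q t 1 * (Pi.single i 1 : Vec4) 1)))) (Icc 0 T) t := fun t ht i => by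
    rw [← lineDeriv_hamiltonian_left]; exact h.deriv_ξ t ht i
  have hξ0 : ∀ t ∈ Icc 0 T, HasDerivWithinAt (fun s => ξ s 0)
      (-((ξ t ⬝ᵥ X2 (q t)) * (l.c / 2 + l.α * q t 0))) (Icc 0 T) t := fun t ht =>
    (hξ t ht 0).congr_deriv (by
      rw [(h.ξ_two_three ht).1, (h.ξ_two_three ht).2]; simp)
  have hξ1 : ∀ t ∈ Icc 0 T, HasDerivWithinAt (fun s => ξ s 1)
      (-((ξ t ⬝ᵥ X1 (q t)) * (l.c / 2) + (ξ t ⬝ᵥ X2 (q t)) * (l.α * q t 1))) (Icc 0 T) t :=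
    fun t ht => (hξ t ht 1).congr_deriv (by
      rw [(h.ξ_two_three ht).1, (h.ξ_two_three ht).2]; simp; ring)
  have e1 : EqOn (fun t => ξ t ⬝ᵥ X1 (q t)) (fun t => ξ t 0 - l.c * q t 1 / 2) (Icc 0 T) :=
    fun t ht => by simp only [dotProduct_X1, (h.ξ_two_three ht).1]
  have e2 : EqOn (fun t => ξ t ⬝ᵥ X2 (q t))
      (fun t => ξ t 1 + l.c * q t 0 / 2 + l.α * (q t 0 ^ 2 + q t 1 ^ 2) / 2) (Icc 0 T) :=
    fun t ht => by simp only [dotProduct_X2, (h.ξ_two_three ht).1, (h.ξ_two_three ht).2]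
  refine ⟨fun t ht => ?_, fun t ht => ?_, fun t ht => ?_⟩
  · refine (((hξ0 t ht).sub (((hq1 t ht).const_mul l.c).div_const 2)).congr_deriv ?_).congr
      e1 (e1 ht)
    ring
  · refine ((((hξ1 t ht).add (((hq0 t ht).const_mul l.c).div_const 2)).add
      (((((hq0 t ht).pow 2).add ((hq1 t ht).pow 2)).const_mul l.α).div_const 2)).congr_deriv
        ?_).congr e2 (e2 ht)
    norm_num
    ring
  · exact (((hq0 t ht).const_mul l.α).const_add l.c).congr_deriv (by ring)

theorem IsNormalExtremal.dotProduct_init {l : Covector} {T : ℝ} {q ξ : ℝ → Vec4}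
    (h : IsNormalExtremal l T q ξ) : ξ 0 ⬝ᵥ X1 (q 0) = Real.sinh l.θ ∧
      ξ 0 ⬝ᵥ X2 (q 0) = Real.cosh l.θ ∧ l.c + l.α * q 0 0 = l.c := by
  rw [dotProduct_X1, dotProduct_X2, h.init_q, h.init_ξ]
  simp [Covector.toVec]

theorem hasDerivAt_am_linear {m : ℝ} (hm : m < 1) (u r t : ℝ) :
    HasDerivAt (fun s => am m (u + r * s)) (r * delta m (am m (u + r * t))) t := by
  have h : HasDerivAt (fun s => u + r * s) r t := by
    simpa using ((hasDerivAt_id t).const_mul r).const_add u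
  exact ((hasDerivAt_am hm (u + r * t)).comp t h).congr_deriv (mul_comm _ _)

theorem cos_am_pos {m : ℝ} (hm : m < 1) {u : ℝ} (hu : u ∈ Ioo (-ellipticK m) (ellipticK m)) :
    0 < Real.cos (am m u) :=
  Real.cos_pos_of_mem_Ioo ((am_mem_Ioo_iff hm u).2 hu)

theorem add_mul_mem_Ioo {K u r t : ℝ} (hr : 0 < r) (hu : u ∈ Ioo (-K) K) (ht : 0 ≤ t)
    (htK : t < (K - u) / r) : u + r * t ∈ Ioo (-K) K := by
  rw [lt_div_iff₀ hr] at htK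
  have := mul_nonneg hr.le ht
  exact ⟨by linarith [hu.1], by linarith⟩

/-- A solution that carries a pole at the phase `π/2` does not reach this phase. -/
theorem lt_of_mul_cos_am_eq {m u r T : ℝ} (hm : m < 1) (hr : 0 < r)
    (hu : u ∈ Ioo (-ellipticK m) (ellipticK m)) {f N : ℝ → ℝ} (hf : ContinuousOn f (Icc 0 T))
    (hN : Continuous N) (hN0 : N (Real.pi / 2) ≠ 0)
    (h : ∀ t, 0 ≤ t → t ≤ T → t < (ellipticK m - u) / r →
      f t * Real.cos (am m (u + r * t)) = N (am m (u + r * t))) :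
    T < (ellipticK m - u) / r := by
  by_contra! hT
  set τ := (ellipticK m - u) / r with hτ
  have hτ0 : 0 < τ := div_pos (by linarith [hu.2]) hr
  have hφ : Continuous fun t => am m (u + r * t) :=
    (continuous_am hm).comp (by fun_prop)
  have hsub : Ioo 0 τ ⊆ Icc 0 T := fun t ht => ⟨ht.1.le, ht.2.le.trans hT⟩
  have h1 : ContinuousWithinAt (fun t => f t * Real.cos (am m (u + r * t)) -
      N (am m (u + r * t))) (Ioo 0 τ) τ :=
    (((hf τ ⟨hτ0.le, hT⟩).mono hsub).mul (Real.continuous_cos.comp hφ).continuousWithinAt).sub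
      (hN.comp hφ).continuousWithinAt
  have h2 : EqOn (fun t => f t * Real.cos (am m (u + r * t)) - N (am m (u + r * t)))
      (fun _ => 0) (Ioo 0 τ) := fun t ht => by
    simp only [h t ht.1.le (ht.2.le.trans hT) ht.2, sub_self]
  have hne : (nhdsWithin τ (Ioo 0 τ)).NeBot := by
    rw [← mem_closure_iff_nhdsWithin_neBot, closure_Ioo hτ0.ne]
    exact ⟨hτ0.le, le_rfl⟩
  have h3 := tendsto_nhds_unique_of_eventuallyEq h1 (tendsto_const_nhds (x := (0 : ℝ)))
    (Filter.eventuallyEq_of_mem self_mem_nhdsWithin h2)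
  have h4 : u + r * τ = ellipticK m := by rw [hτ]; field_simp; ring
  simp only [h4, am_ellipticK hm, Real.cos_pi_div_two] at h3
  apply hN0
  linarith

theorem cutTime_le_of_forall {l : Covector} {B : ℝ}
    (h : ∀ t q ξ, 0 < t → IsNormalExtremal l t q ξ → IsOptimal t q → t ≤ B) :
    cutTime l ≤ ENNReal.ofReal B := by
  refine sSup_le ?_
  rintro τ ⟨t, ht, rfl, q, ξ, hn, ho⟩
  exact ENNReal.ofReal_le_ofReal (h t q ξ ht hn ho)

/-- Functions of the phase that solve the vertical system. -/
theorem isVertical_comp_am {m r α u T : ℝ} (hm : m < 1) {k₁ k₂ k₃ : ℝ → ℝ} {s : Set ℝ}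
    (hs : ∀ t ∈ Icc 0 T, am m (u + r * t) ∈ s)
    (h₁ : ∀ x ∈ s, ∃ d, HasDerivAt k₁ d x ∧ d * (r * delta m x) = -(k₂ x * k₃ x))
    (h₂ : ∀ x ∈ s, ∃ d, HasDerivAt k₂ d x ∧ d * (r * delta m x) = -(k₁ x * k₃ x))
    (h₃ : ∀ x ∈ s, ∃ d, HasDerivAt k₃ d x ∧ d * (r * delta m x) = -(α * k₁ x)) :
    IsVertical α T (fun t => k₁ (am m (u + r * t))) (fun t => k₂ (am m (u + r * t)))
      (fun t => k₃ (am m (u + r * t))) := by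
  refine ⟨fun t ht => ?_, fun t ht => ?_, fun t ht => ?_⟩
  · obtain ⟨d, hd, e⟩ := h₁ _ (hs t ht)
    exact ((hd.comp t (hasDerivAt_am_linear hm u r t)).congr_deriv e).hasDerivWithinAt
  · obtain ⟨d, hd, e⟩ := h₂ _ (hs t ht)
    exact ((hd.comp t (hasDerivAt_am_linear hm u r t)).congr_deriv e).hasDerivWithinAt
  · obtain ⟨d, hd, e⟩ := h₃ _ (hs t ht)
    exact ((hd.comp t (hasDerivAt_am_linear hm u r t)).congr_deriv e).hasDerivWithinAt

theorem isVertical_of_phase₂ {m r p α σ C u T : ℝ} (hm : m < 1) (hα : α ≠ 0) (hσ : σ ^ 2 = 1)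
    (hC : C ^ 2 = 2 * p) (hr : r ^ 2 = (p + 2 * α) / 2) (hmr : m * r ^ 2 = α)
    (hcos : ∀ t ∈ Icc 0 T, Real.cos (am m (u + r * t)) ≠ 0) :
    IsVertical α T
      (fun t => σ * (C * r) * delta m (am m (u + r * t)) / (α * Real.cos (am m (u + r * t)) ^ 2))
      (fun t => 1 + p / (α * Real.cos (am m (u + r * t)) ^ 2))
      (fun t => -σ * C * Real.sin (am m (u + r * t)) / Real.cos (am m (u + r * t))) := by
  refine isVertical_comp_am hm (s := {x | Real.cos x ≠ 0})
    (k₁ := fun x => σ * (C * r) * delta m x / (α * Real.cos x ^ 2))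
    (k₂ := fun x => 1 + p / (α * Real.cos x ^ 2))
    (k₃ := fun x => -σ * C * Real.sin x / Real.cos x) hcos ?_ ?_ ?_
  all_goals
    intro x (hc : Real.cos x ≠ 0)
    have hD := (delta_pos hm x).ne'
    have hD2 := delta_sq hm x
    have hs := Real.hasDerivAt_sin x
    have hcs := Real.hasDerivAt_cos x
    have hd := hasDerivAt_delta hm x
    have hsc := Real.sin_sq_add_cos_sq x
  · refine ⟨_, (hd.const_mul (σ * (C * r))).fun_div ((hcs.fun_pow 2).const_mul α)
      (by positivity), ?_⟩
    have hp : p = 2 * r ^ 2 - 2 * α := by linarith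
    field_simp
    norm_num
    linear_combination (Real.sin x * Real.cos x * σ * C) * (2 * r ^ 2 * hD2 - hp -
      2 * m * r ^ 2 * hsc - (2 - Real.cos x ^ 2) * hmr)
  · refine ⟨_, (((hasDerivAt_const x p).fun_div ((hcs.fun_pow 2).const_mul α)
      (by positivity)).const_add 1), ?_⟩
    field_simp
    norm_num
    linear_combination (-(Real.cos x * Real.sin x * r)) * (C ^ 2 * hσ + hC)
  · refine ⟨_, (hs.const_mul (-σ * C)).fun_div hcs hc, ?_⟩
    field_simp
    linear_combination (-(σ * C * r)) * hsc

theorem isVertical_of_phase₃ {m r α σ u T : ℝ} (hm : m < 1) (hσ : σ ^ 2 = 1)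
    (hmr : m * r ^ 2 = r ^ 2 - α)
    (hcos : ∀ t ∈ Icc 0 T, Real.cos (am m (u + r * t)) ≠ 0) :
    IsVertical α T
      (fun t => -σ * (2 * Real.sin (am m (u + r * t))) / Real.cos (am m (u + r * t)) ^ 2)
      (fun t => (1 + Real.sin (am m (u + r * t)) ^ 2) / Real.cos (am m (u + r * t)) ^ 2)
      (fun t => σ * (2 * r * delta m (am m (u + r * t))) / Real.cos (am m (u + r * t))) := by
  refine isVertical_comp_am hm (s := {x | Real.cos x ≠ 0})
    (k₁ := fun x => -σ * (2 * Real.sin x) / Real.cos x ^ 2)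
    (k₂ := fun x => (1 + Real.sin x ^ 2) / Real.cos x ^ 2)
    (k₃ := fun x => σ * (2 * r * delta m x) / Real.cos x) hcos ?_ ?_ ?_
  all_goals
    intro x (hc : Real.cos x ≠ 0)
    have hD := (delta_pos hm x).ne'
    have hD2 := delta_sq hm x
    have hs := Real.hasDerivAt_sin x
    have hcs := Real.hasDerivAt_cos x
    have hd := hasDerivAt_delta hm x
    have hsc := Real.sin_sq_add_cos_sq x
  · refine ⟨_, ((hs.const_mul 2).const_mul (-σ)).fun_div (hcs.fun_pow 2) (by positivity), ?_⟩
    field_simp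
    norm_num
    linear_combination (-(σ * r * Real.cos x)) * hsc
  · refine ⟨_, ((hs.fun_pow 2).const_add 1).fun_div (hcs.fun_pow 2) (by positivity), ?_⟩
    field_simp
    norm_num
    linear_combination (2 * r * Real.sin x * Real.cos x) * (hsc - 2 * hσ)
  · refine ⟨_, ((hd.const_mul (2 * r)).const_mul σ).fun_div hcs hc, ?_⟩
    field_simp
    linear_combination (σ * Real.sin x) * (r ^ 2 * hD2 - m * r ^ 2 * hsc - hmr)

theorem eq_mul_of_sq_eq_sq {σ y R : ℝ} (hσ : σ ^ 2 = 1) (h : 0 ≤ σ * y) (hR : 0 ≤ R)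
    (e : y ^ 2 = R ^ 2) : y = σ * R := by
  have h1 : σ * y = R := (pow_left_inj₀ h hR two_ne_zero).1 (by rw [mul_pow, hσ, one_mul, e])
  rw [← h1]
  linear_combination (-y) * hσ

theorem Covector.sign_θ_sq {l : Covector} (h : l.θ ≠ 0) : Real.sign l.θ ^ 2 = 1 := by
  rcases Real.sign_apply_eq_of_ne_zero l.θ h with h | h <;> rw [h] <;> norm_num

theorem Covector.sign_c_sq {l : Covector} (h : l.c ≠ 0) : Real.sign l.c ^ 2 = 1 := by
  rcases Real.sign_apply_eq_of_ne_zero l.c h with h | h <;> rw [h] <;> norm_num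

theorem Covector.m2_lt_one {l : Covector} (hl : l ∈ C2) : l.m2 < 1 := by
  obtain ⟨h1, h2⟩ := hl
  unfold Covector.m2
  rw [div_lt_one (by linarith)]
  linarith

theorem Covector.ae2_pos {l : Covector} (hl : l ∈ C2) : 0 < l.ae2 := by
  obtain ⟨h1, h2⟩ := hl
  exact Real.sqrt_pos.2 (by linarith)

theorem Covector.ae2_sq {l : Covector} (hl : l ∈ C2) : l.ae2 ^ 2 = (l.α - l.E) / 2 := by
  obtain ⟨h1, h2⟩ := hl
  exact Real.sq_sqrt (by linarith)

theorem Covector.θ_ne_zero {l : Covector} (hl : l ∈ C2) : l.θ ≠ 0 := by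
  obtain ⟨h1, h2⟩ := hl
  intro h
  simp only [Covector.E, h, Real.cosh_zero] at h2
  nlinarith [sq_nonneg l.c]

theorem Covector.m3_lt_one {l : Covector} (hl : l ∈ C3) : l.m3 < 1 := by
  obtain ⟨h1, h2⟩ := hl
  unfold Covector.m3
  rw [div_lt_one (by linarith)]
  linarith

theorem Covector.ae3_pos {l : Covector} (hl : l ∈ C3) : 0 < l.ae3 := by
  obtain ⟨h1, h2⟩ := hl
  exact Real.sqrt_pos.2 (by linarith)

theorem Covector.ae3_sq {l : Covector} (hl : l ∈ C3) : l.ae3 ^ 2 = (l.E + l.α) / 2 := by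
  obtain ⟨h1, h2⟩ := hl
  exact Real.sq_sqrt (by linarith)

theorem Covector.c_ne_zero {l : Covector} (hl : l ∈ C3) : l.c ≠ 0 := by
  obtain ⟨h1, h2⟩ := hl
  intro h
  simp only [Covector.E, h] at h2
  nlinarith [Real.one_le_cosh l.θ]

theorem mul_mem_Ioo_of_mem_Ioo_div {K r φ : ℝ} (hr : 0 < r) (h : φ ∈ Ioo (-(K / r)) (K / r)) :
    r * φ ∈ Ioo (-K) K := by
  rw [mem_Ioo, ← neg_div, div_lt_iff₀ hr, lt_div_iff₀ hr] at h
  exact ⟨by linarith [h.1], by linarith [h.2]⟩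

theorem div_mem_Ioo_div_of_mem_Ioo {K r ψ : ℝ} (hr : 0 < r) (h : ψ ∈ Ioo (-K) K) :
    ψ / r ∈ Ioo (-(K / r)) (K / r) := by
  rw [mem_Ioo, ← neg_div, div_lt_div_iff_of_pos_right hr, div_lt_div_iff_of_pos_right hr]
  exact h

theorem existsUnique_isPhase2 {l : Covector} (hl : l ∈ C2) : ∃! φ : ℝ, l.IsPhase2 φ := by
  have hm := Covector.m2_lt_one hl
  have hr := Covector.ae2_pos hl
  have hσ := Covector.sign_θ_sq (Covector.θ_ne_zero hl)
  have hp : 0 < -l.α - l.E := by linarith [hl.2]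
  have hC : 0 < Real.sqrt (2 * (-l.α - l.E)) := Real.sqrt_pos.2 (by linarith)
  have hσ0 : Real.sign l.θ ≠ 0 := fun h => by rw [h] at hσ; norm_num at hσ
  refine existsUnique_of_exists_of_unique ?_ ?_
  · set x := Real.arctan (-(Real.sign l.θ * l.c / Real.sqrt (2 * (-l.α - l.E)))) with hx
    have hxI : x ∈ Ioo (-(Real.pi / 2)) (Real.pi / 2) := Real.arctan_mem_Ioo _
    have hc : 0 < Real.cos x := Real.cos_pos_of_mem_Ioo hxI
    have htan : Real.sin x / Real.cos x =
        -(Real.sign l.θ * l.c / Real.sqrt (2 * (-l.α - l.E))) := by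
      rw [← Real.tan_eq_sin_div_cos, hx, Real.tan_arctan]
    have hu : ellipticF l.m2 x ∈ Ioo (-ellipticK l.m2) (ellipticK l.m2) := by
      rw [← am_mem_Ioo_iff hm, am_ellipticF hm]; exact hxI
    refine ⟨ellipticF l.m2 x / l.ae2, div_mem_Ioo_div_of_mem_Ioo hr hu, ?_, ?_⟩
    · rw [mul_div_cancel₀ _ hr.ne', sn, cn, am_ellipticF hm, mul_div_assoc, htan]
      field_simp
      linear_combination (-l.c) * hσ
    · rw [mul_div_cancel₀ _ hr.ne', dn_eq, cn, am_ellipticF hm]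
      have hα : 0 < l.α := hl.1
      have hE : l.E = l.c ^ 2 / 2 - l.α * Real.cosh l.θ := rfl
      have hsc := Real.sin_sq_add_cos_sq x
      have hq : 0 < l.α - l.E := by linarith
      have hmq : l.m2 * (l.α - l.E) = 2 * l.α := by unfold Covector.m2; field_simp
      have h1 : l.c ^ 2 * Real.cos x ^ 2 = 2 * (-l.α - l.E) * Real.sin x ^ 2 := by
        have h2 : Real.sin x * Real.sqrt (2 * (-l.α - l.E)) =
            -(Real.sign l.θ * l.c * Real.cos x) := by
          field_simp at htan
          linarith
        have h3 := congrArg (· ^ 2) h2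
        simp only [mul_pow, neg_sq, hσ, Real.sq_sqrt (show 0 ≤ 2 * (-l.α - l.E) by linarith)] at h3
        linarith
      have hp2 : -l.α - l.E = (l.α * Real.cosh l.θ - l.α) * Real.cos x ^ 2 := by
        linear_combination (-1 / 2) * h1 - (-l.α - l.E) * hsc - Real.cos x ^ 2 * hE
      rw [mul_assoc, mul_div_assoc]
      refine eq_mul_of_sq_eq_sq hσ ?_ ?_ ?_
      · rcases (Covector.θ_ne_zero hl).lt_or_gt with h | h
        · rw [Real.sign_of_neg h]; linarith [Real.sinh_neg_iff.2 h]
        · rw [Real.sign_of_pos h]; linarith [Real.sinh_pos_iff.2 h]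
      · have := delta_pos hm x
        positivity
      · rw [Real.sinh_sq, div_pow, mul_pow, mul_pow, Real.sq_sqrt hp.le, Real.sq_sqrt hq.le,
          delta_sq hm, mul_assoc, mul_sub, ← mul_assoc _ l.m2, mul_comm _ l.m2, hmq, mul_one,
          eq_div_iff (by positivity)]
        have : l.α - l.E - 2 * l.α * Real.sin x ^ 2 =
            (-l.α - l.E) + 2 * l.α * Real.cos x ^ 2 := by
          linear_combination (-2 * l.α) * hsc
        rw [this, hp2]
        ring
  · intro φ φ' h h'
    have hu := mul_mem_Ioo_of_mem_Ioo_div hr h.1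
    have hu' := mul_mem_Ioo_of_mem_Ioo_div hr h'.1
    have hI := (am_mem_Ioo_iff hm _).2 hu
    have hI' := (am_mem_Ioo_iff hm _).2 hu'
    have e : Real.tan (am l.m2 (l.ae2 * φ)) = Real.tan (am l.m2 (l.ae2 * φ')) := by
      have := h.2.1.symm.trans h'.2.1
      rw [mul_div_assoc, mul_div_assoc] at this
      rw [Real.tan_eq_sin_div_cos, Real.tan_eq_sin_div_cos]
      exact mul_left_cancel₀ (mul_ne_zero (neg_ne_zero.2 hσ0) hC.ne') this
    exact mul_left_cancel₀ hr.ne' ((strictMono_am hm).injective (Real.injOn_tan hI hI' e))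

theorem existsUnique_isPhase3 {l : Covector} (hl : l ∈ C3) : ∃! φ : ℝ, l.IsPhase3 φ := by
  have hm := Covector.m3_lt_one hl
  have hr := Covector.ae3_pos hl
  have hσ0 : Real.sign l.c ≠ 0 := fun h =>
    Covector.c_ne_zero hl (Real.sign_eq_zero_iff.1 h)
  refine existsUnique_of_exists_of_unique ?_ ?_
  · set w := -(Real.sign l.c * Real.tanh (l.θ / 2)) with hw
    set x := Real.arcsin w with hx
    have hσ := Covector.sign_c_sq (Covector.c_ne_zero hl)
    have hch := Real.cosh_pos (l.θ / 2)
    have hC2 := Real.cosh_sq (l.θ / 2)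
    have hw2 : w ^ 2 * Real.cosh (l.θ / 2) ^ 2 = Real.sinh (l.θ / 2) ^ 2 := by
      rw [hw, neg_sq, mul_pow, hσ, one_mul, ← mul_pow, Real.tanh_eq_sinh_div_cosh,
        div_mul_cancel₀ _ hch.ne']
    have hw1 : w ^ 2 < 1 := by
      by_contra! h
      nlinarith [mul_le_mul_of_nonneg_right h (sq_nonneg (Real.cosh (l.θ / 2)))]
    have hwI : -1 < w ∧ w < 1 := abs_lt.1 ((sq_lt_one_iff_abs_lt_one w).1 hw1)
    have hsin : Real.sin x = w := Real.sin_arcsin hwI.1.le hwI.2.le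
    have hxI : x ∈ Ioo (-(Real.pi / 2)) (Real.pi / 2) :=
      ⟨Real.neg_pi_div_two_lt_arcsin.2 hwI.1, Real.arcsin_lt_pi_div_two.2 hwI.2⟩
    have hc : 0 < Real.cos x := Real.cos_pos_of_mem_Ioo hxI
    have hc2 : Real.cos x ^ 2 * Real.cosh (l.θ / 2) ^ 2 = 1 := by
      rw [Real.cos_sq', hsin, sub_mul, hw2]
      linarith
    have hu : ellipticF l.m3 x ∈ Ioo (-ellipticK l.m3) (ellipticK l.m3) := by
      rw [← am_mem_Ioo_iff hm, am_ellipticF hm]; exact hxI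
    refine ⟨ellipticF l.m3 x / l.ae3, div_mem_Ioo_div_of_mem_Ioo hr hu, ?_, ?_⟩
    · rw [mul_div_cancel₀ _ hr.ne', dn_eq, cn, am_ellipticF hm, mul_div_assoc]
      refine eq_mul_of_sq_eq_sq hσ (Real.sign_mul_nonneg _) ?_ ?_
      · have := delta_pos hm x
        positivity
      · have hE : l.E = l.c ^ 2 / 2 - l.α * Real.cosh l.θ := rfl
        have hmr : l.m3 * (l.E + l.α) = l.E - l.α := by
          have : l.E + l.α ≠ 0 := by linarith [hl.2]
          unfold Covector.m3; field_simp
        have hcosh : Real.cosh l.θ = Real.cosh (l.θ / 2) ^ 2 + Real.sinh (l.θ / 2) ^ 2 := by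
          rw [← Real.cosh_two_mul]; congr 1; ring
        rw [div_pow, mul_pow, mul_pow, Covector.ae3_sq hl, delta_sq hm, hsin,
          eq_div_iff (by positivity)]
        refine mul_right_cancel₀ (pow_pos hch 2).ne' ?_
        rw [mul_assoc, hc2]
        linear_combination (-2) * hE + 2 * l.α * hcosh + 2 * w ^ 2 * Real.cosh (l.θ / 2) ^ 2 * hmr
          + 2 * (l.E - l.α) * hw2 - 2 * l.E * hC2
    · rw [mul_div_cancel₀ _ hr.ne', sn, cn, am_ellipticF hm, hsin, eq_div_iff (by positivity)]
      refine mul_right_cancel₀ (pow_pos hch 2).ne' ?_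
      have hsinh : Real.sinh l.θ = 2 * Real.sinh (l.θ / 2) * Real.cosh (l.θ / 2) := by
        rw [← Real.sinh_two_mul]; congr 1; ring
      rw [mul_assoc, hc2, hsinh, hw, Real.tanh_eq_sinh_div_cosh]
      field_simp
      linear_combination (-Real.sinh (l.θ / 2)) * hσ
  · intro φ φ' h h'
    have hu := mul_mem_Ioo_of_mem_Ioo_div hr h.1
    have hu' := mul_mem_Ioo_of_mem_Ioo_div hr h'.1
    have hI := (am_mem_Ioo_iff hm _).2 hu
    have hI' := (am_mem_Ioo_iff hm _).2 hu'
    have e := h.2.2.symm.trans h'.2.2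
    have hc := cos_am_pos hm hu
    have hc' := cos_am_pos hm hu'
    simp only [sn, cn] at e
    have e2 : Real.sin (am l.m3 (l.ae3 * φ)) = Real.sin (am l.m3 (l.ae3 * φ')) := by
      have hs := Real.sin_sq_add_cos_sq (am l.m3 (l.ae3 * φ))
      have hs' := Real.sin_sq_add_cos_sq (am l.m3 (l.ae3 * φ'))
      generalize am l.m3 (l.ae3 * φ) = x at *
      generalize am l.m3 (l.ae3 * φ') = y at *
      rw [div_eq_div_iff (by positivity) (by positivity)] at e
      have e3 : -Real.sign l.c * 2 * ((Real.sin x - Real.sin y) *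
          (1 + Real.sin x * Real.sin y)) = 0 := by
        rw [← sub_eq_zero] at e
        rw [← e, show Real.cos x ^ 2 = 1 - Real.sin x ^ 2 by linarith,
          show Real.cos y ^ 2 = 1 - Real.sin y ^ 2 by linarith]
        ring
      have h1 : 0 < 1 + Real.sin x * Real.sin y := by
        nlinarith [sq_nonneg (Real.sin x + Real.sin y), pow_pos hc 2, pow_pos hc' 2]
      have := (mul_eq_zero.1 e3).resolve_left (by simpa using hσ0)
      linarith [(mul_eq_zero.1 this).resolve_right h1.ne']
    exact mul_left_cancel₀ hr.ne' ((strictMono_am hm).injective (Real.injOn_sin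
      (Ioo_subset_Icc_self hI) (Ioo_subset_Icc_self hI') e2))

theorem cutTime_le_of_isPhase2 {l : Covector} (hl : l ∈ C2) {φ : ℝ} (h : l.IsPhase2 φ) :
    cutTime l ≤ ENNReal.ofReal ((ellipticK l.m2 - l.ae2 * φ) / l.ae2) := by
  have hm := Covector.m2_lt_one hl
  have hr := Covector.ae2_pos hl
  have hr2 := Covector.ae2_sq hl
  have hσ := Covector.sign_θ_sq (Covector.θ_ne_zero hl)
  have hp : 0 < -l.α - l.E := by linarith [hl.2]
  have hα : 0 < l.α := hl.1
  have hu := mul_mem_Ioo_of_mem_Ioo_div hr h.1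
  have hCpos : 0 < Real.sqrt (2 * (-l.α - l.E)) := Real.sqrt_pos.2 (by linarith)
  have hC : Real.sqrt (2 * (-l.α - l.E)) ^ 2 = 2 * (-l.α - l.E) := Real.sq_sqrt (by linarith)
  have hCr : Real.sqrt (-l.α - l.E) * Real.sqrt (l.α - l.E) =
      Real.sqrt (2 * (-l.α - l.E)) * l.ae2 := by
    unfold Covector.ae2
    rw [← Real.sqrt_mul hp.le, ← Real.sqrt_mul (by linarith)]
    congr 1; ring
  have hσ0 : Real.sign l.θ ≠ 0 := fun h => by rw [h] at hσ; norm_num at hσ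
  refine cutTime_le_of_forall fun T q ξ hT hn _ => ?_
  refine (lt_of_mul_cos_am_eq hm hr hu
    (N := fun x => -Real.sign l.θ * Real.sqrt (2 * (-l.α - l.E)) * Real.sin x)
    (fun t ht => (hn.isVertical.deriv₃ t ht).continuousWithinAt) (by fun_prop) ?_ ?_).le
  · exact mul_ne_zero (mul_ne_zero (neg_ne_zero.2 hσ0) hCpos.ne') (by simp)
  · intro t ht0 htT ht
    have hcos : ∀ s ∈ Icc 0 t, 0 < Real.cos (am l.m2 (l.ae2 * φ + l.ae2 * s)) := fun s hs =>
      cos_am_pos hm (add_mul_mem_Ioo hr hu hs.1 (hs.2.trans_lt ht))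
    have hv := isVertical_of_phase₂ (p := -l.α - l.E) hm hα.ne' hσ hC
      (by rw [hr2]; ring)
      (by
        have : l.α - l.E ≠ 0 := by linarith
        rw [hr2]; unfold Covector.m2; field_simp)
      (fun s hs => (hcos s hs).ne')
    obtain ⟨i1, i2, i3⟩ := hn.dotProduct_init
    have hc0 := hcos 0 ⟨le_rfl, ht0⟩
    have hb := h.2.1
    have hb' := h.2.2
    simp only [sn, cn] at hb hb'
    have e := ((hn.isVertical.mono htT).eqOn hv ?_ ?_ ?_ ⟨ht0, le_rfl⟩).2.2
    · rw [e, div_mul_cancel₀ _ (hcos t ⟨ht0, le_rfl⟩).ne']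
    · rw [i1, hb', hCr, dn_eq]; simp
    · rw [i2]; simp only [mul_zero, add_zero] at hc0 ⊢
      have hE : l.E = l.c ^ 2 / 2 - l.α * Real.cosh l.θ := rfl
      have hsc := Real.sin_sq_add_cos_sq (am l.m2 (l.ae2 * φ))
      rw [eq_div_iff hc0.ne'] at hb
      have h3 := congrArg (· ^ 2) hb
      simp only [mul_pow, neg_sq, hσ, hC] at h3
      field_simp
      linear_combination (1 / 2) * h3 + (-l.α - l.E) * hsc +
        Real.cos (am l.m2 (l.ae2 * φ)) ^ 2 * hE
    · rw [i3, hb]; simp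

theorem cutTime_le_of_isPhase3 {l : Covector} (hl : l ∈ C3) {φ : ℝ} (h : l.IsPhase3 φ) :
    cutTime l ≤ ENNReal.ofReal ((ellipticK l.m3 - l.ae3 * φ) / l.ae3) := by
  have hm := Covector.m3_lt_one hl
  have hr := Covector.ae3_pos hl
  have hr2 := Covector.ae3_sq hl
  have hα : 0 < l.α := hl.1
  have hu := mul_mem_Ioo_of_mem_Ioo_div hr h.1
  have hσ0 : Real.sign l.c ≠ 0 := fun h =>
    Covector.c_ne_zero hl (Real.sign_eq_zero_iff.1 h)
  have hσ := Covector.sign_c_sq (Covector.c_ne_zero hl)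
  have hmr : l.m3 * l.ae3 ^ 2 = l.ae3 ^ 2 - l.α := by
    have : l.E + l.α ≠ 0 := by linarith [hl.2]
    rw [hr2]; unfold Covector.m3; field_simp; ring
  refine cutTime_le_of_forall fun T q ξ hT hn _ => ?_
  refine (lt_of_mul_cos_am_eq hm hr hu
    (N := fun x => Real.sign l.c * (2 * l.ae3 * delta l.m3 x))
    (fun t ht => (hn.isVertical.deriv₃ t ht).continuousWithinAt)
    (by have := continuous_delta l.m3; fun_prop) ?_ ?_).le
  · simp [hσ0, hr.ne', (delta_pos hm _).ne']
  · intro t ht0 htT ht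
    have hcos : ∀ s ∈ Icc 0 t, 0 < Real.cos (am l.m3 (l.ae3 * φ + l.ae3 * s)) := fun s hs =>
      cos_am_pos hm (add_mul_mem_Ioo hr hu hs.1 (hs.2.trans_lt ht))
    have hv := isVertical_of_phase₃ hm hσ hmr (fun s hs => (hcos s hs).ne')
    obtain ⟨i1, i2, i3⟩ := hn.dotProduct_init
    have hc0 := hcos 0 ⟨le_rfl, ht0⟩
    have hb := h.2.1
    have hb' := h.2.2
    simp only [sn, cn] at hb hb'
    have e := ((hn.isVertical.mono htT).eqOn hv ?_ ?_ ?_ ⟨ht0, le_rfl⟩).2.2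
    · rw [e, div_mul_cancel₀ _ (hcos t ⟨ht0, le_rfl⟩).ne']
    · rw [i1, hb']; simp
    · rw [i2]; simp only [mul_zero, add_zero] at hc0 ⊢
      have hsc := Real.sin_sq_add_cos_sq (am l.m3 (l.ae3 * φ))
      refine (pow_left_inj₀ (Real.cosh_pos _).le (by positivity) two_ne_zero).1 ?_
      rw [Real.cosh_sq, hb', div_pow, mul_pow, neg_sq, hσ, div_pow]
      field_simp
      linear_combination (Real.cos (am l.m3 (l.ae3 * φ)) ^ 2 + 1 -
        Real.sin (am l.m3 (l.ae3 * φ)) ^ 2) * hsc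
    · rw [i3]
      nth_rewrite 1 [hb]
      rw [dn_eq]; simp

/-- The differentiable functions that vanish at both ends of `[0, T]`. -/
def testSpace (T : ℝ) : Submodule ℝ (ℝ → ℝ) where
  carrier := {φ | ContDiff ℝ 1 φ ∧ φ 0 = 0 ∧ φ T = 0}
  zero_mem' := ⟨contDiff_const, rfl, rfl⟩
  add_mem' := fun {f g} hf hg => ⟨hf.1.add hg.1, by simp [hf.2.1, hg.2.1], by
    simp [hf.2.2, hg.2.2]⟩
  smul_mem' := fun c f hf => ⟨contDiff_const.smul hf.1, by simp [hf.2.1], by simp [hf.2.2]⟩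

/-- The functionals `φ(a) - φ(b)`, `∫ φ w`, `∫ φ G w`. -/
def testMap (T a b : ℝ) {G w : ℝ → ℝ} (hG : Continuous G) (hw : Continuous w) :
    testSpace T →ₗ[ℝ] ℝ × ℝ × ℝ where
  toFun φ := (φ.1 a - φ.1 b, ∫ t in (0 : ℝ)..T, φ.1 t * w t, ∫ t in (0 : ℝ)..T, φ.1 t * (G t * w t))
  map_add' φ ψ := by
    have hφ := φ.2.1.continuous
    have hψ := ψ.2.1.continuous
    ext
    · simp; ring
    · simp only [Submodule.coe_add, Pi.add_apply, add_mul, Prod.mk_add_mk]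
      exact intervalIntegral.integral_add ((hφ.mul hw).intervalIntegrable _ _)
        ((hψ.mul hw).intervalIntegrable _ _)
    · simp only [Submodule.coe_add, Pi.add_apply, add_mul, Prod.mk_add_mk]
      exact intervalIntegral.integral_add ((hφ.mul (hG.mul hw)).intervalIntegrable _ _)
        ((hψ.mul (hG.mul hw)).intervalIntegrable _ _)
  map_smul' c φ := by
    ext
    · simp; ring
    · simp [mul_assoc]
    · simp [mul_assoc]

theorem surjective_testMap {T a b : ℝ} (ha : 0 < a) (hab : a < b) (hb : b < T) {G w : ℝ → ℝ}
    (hG : Continuous G) (hw : Continuous w) (hw0 : ∀ t, 0 < w t)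
    (hGne : ∃ s ∈ Ioo 0 a, ∃ t ∈ Ioo 0 a, G s ≠ G t) :
    Function.Surjective (testMap T a b hG hw) := by
  rw [← LinearMap.range_eq_top]
  by_contra hne
  obtain ⟨f, hf0, hf⟩ := Submodule.exists_le_ker_of_lt_top _ (lt_top_iff_ne_top.2 hne)
  set A := f (1, 0, 0)
  set B := f (0, 1, 0)
  set C := f (0, 0, 1)
  have hfe : ∀ x y z, f (x, y, z) = A * x + B * y + C * z := by
    intro x y z
    have : ((x, y, z) : ℝ × ℝ × ℝ) = x • (1, 0, 0) + y • (0, 1, 0) + z • (0, 0, 1) := by simp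
    rw [this, map_add, map_add, map_smul, map_smul, map_smul]
    simp only [smul_eq_mul]
    ring
  have key : ∀ φ : ℝ → ℝ, ContDiff ℝ 1 φ → φ 0 = 0 → φ T = 0 →
      A * (φ a - φ b) + B * (∫ t in (0 : ℝ)..T, φ t * w t) +
        C * (∫ t in (0 : ℝ)..T, φ t * (G t * w t)) = 0 := by
    intro φ h1 h2 h3
    have := hf (LinearMap.mem_range_self (testMap T a b hG hw) ⟨φ, h1, h2, h3⟩)
    rw [LinearMap.mem_ker] at this
    exact (hfe _ _ _).symm.trans this
  have hzero : EqOn (fun t => (B + C * G t) * w t) (fun _ => 0) (Ioo 0 a) := by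
    have hc : Continuous fun t => (B + C * G t) * w t := by fun_prop
    have hae := isOpen_Ioo.ae_eq_zero_of_integral_contDiff_smul_eq_zero (U := Ioo 0 a)
      (f := fun t => (B + C * G t) * w t) (μ := volume)
      (hc.locallyIntegrable.locallyIntegrableOn _) ?_
    · refine Measure.eqOn_open_of_ae_eq (μ := volume) ?_ isOpen_Ioo hc.continuousOn
        continuousOn_const
      exact (ae_restrict_iff' measurableSet_Ioo).2 hae
    · intro g hg _ hgs
      have hg0 : ∀ t, t ∉ Ioo 0 a → g t = 0 := fun t ht =>
        image_eq_zero_of_notMem_tsupport fun h => ht (hgs h)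
      have hk := key g (hg.of_le (by norm_cast)) (hg0 0 (by simp))
        (hg0 T (fun h => by linarith [h.2]))
      rw [hg0 a (by simp), hg0 b (fun h => by linarith [h.2])] at hk
      have hgc := hg.continuous
      rw [← intervalIntegral.integral_const_mul, ← intervalIntegral.integral_const_mul, sub_zero,
        mul_zero, zero_add, ← intervalIntegral.integral_add
        ((by fun_prop : Continuous fun t => B * (g t * w t)).intervalIntegrable _ _)
        ((by fun_prop : Continuous fun t => C * (g t * (G t * w t))).intervalIntegrable _ _)] at hk
      rw [← intervalIntegral.integral_eq_integral_of_support_subset (a := 0) (b := T)]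
      · refine Eq.trans ?_ hk
        refine intervalIntegral.integral_congr fun t _ => ?_
        simp only [smul_eq_mul]; ring
      · intro t ht
        by_contra h
        refine ht ?_
        simp only [hg0 t fun h' => h ⟨h'.1, by linarith [h'.2]⟩, zero_smul]
  obtain ⟨s, hs, t, ht, hst⟩ := hGne
  have e1 := (mul_eq_zero.1 (hzero hs)).resolve_right (hw0 s).ne'
  have e2 := (mul_eq_zero.1 (hzero ht)).resolve_right (hw0 t).ne'
  have hC : C = 0 := by
    have : C * (G s - G t) = 0 := by linarith
    exact (mul_eq_zero.1 this).resolve_right (sub_ne_zero.2 hst)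
  have hB : B = 0 := by rw [hC] at e1; linarith
  have hA : A = 0 := by
    have := key (fun t => t * (t - b) * (t - T)) (by fun_prop) (by simp) (by simp)
    rw [hB, hC] at this
    simp only [sub_self, mul_zero, zero_mul, sub_zero, add_zero] at this
    have h1 : a * (a - b) * (a - T) ≠ 0 := mul_ne_zero (mul_ne_zero ha.ne' (by linarith))
      (by linarith)
    exact (mul_eq_zero.1 this).resolve_right h1
  apply hf0
  refine LinearMap.ext fun p => ?_
  rw [hfe p.1 p.2.1 p.2.2, hA, hB, hC]
  simp

theorem exists_testFunction {T a b : ℝ} (ha : 0 < a) (hab : a < b) (hb : b < T) {G w : ℝ → ℝ}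
    (hG : Continuous G) (hw : Continuous w) (hw0 : ∀ t, 0 < w t)
    (hGne : ∃ s ∈ Ioo 0 a, ∃ t ∈ Ioo 0 a, G s ≠ G t) (r₀ r₁ r₂ : ℝ) :
    ∃ φ : ℝ → ℝ, ContDiff ℝ 1 φ ∧ φ 0 = 0 ∧ φ T = 0 ∧ φ a - φ b = r₀ ∧
      (∫ t in (0 : ℝ)..T, φ t * w t) = r₁ ∧ (∫ t in (0 : ℝ)..T, φ t * (G t * w t)) = r₂ := by
  obtain ⟨φ, hφ⟩ := surjective_testMap ha hab hb hG hw hw0 hGne (r₀, r₁, r₂)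
  simp only [testMap, LinearMap.coe_mk, AddHom.coe_mk, Prod.mk.injEq] at hφ
  exact ⟨φ.1, φ.2.1, φ.2.2.1, φ.2.2.2, hφ⟩

theorem one_sub_half_sub_sq_le_sqrt {x : ℝ} (hx : |x| ≤ 1 / 2) :
    1 - x / 2 - x ^ 2 ≤ Real.sqrt (1 - x) := by
  obtain ⟨h1, h2⟩ := abs_le.1 hx
  refine Real.le_sqrt_of_sq_le ?_
  nlinarith [mul_nonneg (sq_nonneg x) (show 0 ≤ 7 / 4 - x - x ^ 2 by nlinarith)]

theorem sub_le_sqrt_of_abs_le {M ε v w d : ℝ} (hM : 0 ≤ M) (hε0 : 0 < ε) (hε1 : ε ≤ 1)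
    (hεM : 8 * ε * M ^ 2 ≤ 1 / 2) (h : w ^ 2 - v ^ 2 = 1) (hv : |v| ≤ M) (hd : |d| ≤ 2 * ε * M) :
    (v + d) ^ 2 < w ^ 2 ∧
    1 - v * d - ε ^ 2 * (2 * M ^ 2 + 64 * M ^ 4) ≤ Real.sqrt (w ^ 2 - (v + d) ^ 2) := by
  have hx : |2 * v * d + d ^ 2| ≤ 8 * ε * M ^ 2 := by
    calc |2 * v * d + d ^ 2| ≤ |2 * v * d| + |d ^ 2| := abs_add_le _ _
      _ = 2 * |v| * |d| + |d| * |d| := by rw [abs_mul, abs_mul, abs_two, abs_pow]; ring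
      _ ≤ 2 * M * (2 * ε * M) + (2 * ε * M) * (2 * 1 * M) := by gcongr; exact hd.trans (by gcongr)
      _ = _ := by ring
  have h4 : w ^ 2 - (v + d) ^ 2 = 1 - (2 * v * d + d ^ 2) := by linear_combination h
  have h7 := (abs_le.1 (hx.trans hεM)).2
  refine ⟨by linarith, ?_⟩
  rw [h4]
  refine le_trans ?_ (one_sub_half_sub_sq_le_sqrt (hx.trans hεM))
  have h5 : (2 * v * d + d ^ 2) ^ 2 ≤ (8 * ε * M ^ 2) ^ 2 := sq_le_sq' (abs_le.1 hx).1
    (abs_le.1 hx).2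
  have h6 : d ^ 2 ≤ (2 * ε * M) ^ 2 := sq_le_sq' (abs_le.1 hd).1 (abs_le.1 hd).2
  have h8 : (8 * ε * M ^ 2) ^ 2 = 64 * (ε ^ 2 * M ^ 4) := by ring
  have h9 : (2 * ε * M) ^ 2 = 4 * (ε ^ 2 * M ^ 2) := by ring
  rw [h8] at h5
  rw [h9] at h6
  have h10 : ε ^ 2 * (2 * M ^ 2 + 64 * M ^ 4) = 2 * (ε ^ 2 * M ^ 2) + 64 * (ε ^ 2 * M ^ 4) := by ring
  rw [h10]
  linarith

theorem exists_small_parameter {ι : Type*} [Finite ι] (S δ : ι → ℝ) (hδ : ∀ i, 0 < δ i) :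
    ∃ ε : ℝ, 0 < ε ∧ ∀ i, ε * S i ≤ δ i := by
  have aux : ∀ i, ∀ᶠ ε in nhdsWithin (0 : ℝ) (Ioi 0), ε * S i ≤ δ i := by
    intro i
    have : Filter.Tendsto (fun ε : ℝ => ε * S i) (nhdsWithin 0 (Ioi 0)) (nhds (0 * S i)) :=
      (Filter.tendsto_id.mono_left nhdsWithin_le_nhds).mul_const (S i)
    rw [zero_mul] at this
    exact this.eventually (ge_mem_nhds (hδ i))
  have h0 : ∀ᶠ ε in nhdsWithin (0 : ℝ) (Ioi 0), 0 < ε := self_mem_nhdsWithin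
  exact (h0.and (Filter.eventually_all.2 aux)).exists

theorem exists_root_near_zero {A B D ε η : ℝ} (hε : 0 < ε) (hη0 : 0 < η) (hη1 : η ≤ 1)
    (h : ε * (|A| + 2 * |B| + |D|) ≤ η) :
    ∃ β, |β| ≤ η ∧ 2 * β + ε * (A + 2 * β * B + β ^ 2 * D) = 0 := by
  have hbd : ∀ β, |β| ≤ η → |ε * (A + 2 * β * B + β ^ 2 * D)| ≤ η := by
    intro β hβ
    rw [abs_mul, abs_of_pos hε]
    refine le_trans (mul_le_mul_of_nonneg_left ?_ hε.le) h
    have h1 : |β| ≤ 1 := hβ.trans hη1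
    have h2 : |2 * β * B| ≤ 2 * |B| := by
      rw [abs_mul, abs_mul, abs_two]
      nlinarith [abs_nonneg B]
    have h3 : |β ^ 2 * D| ≤ |D| := by
      rw [abs_mul, abs_pow]
      exact mul_le_of_le_one_left (abs_nonneg D) (pow_le_one₀ (abs_nonneg β) h1)
    calc |A + 2 * β * B + β ^ 2 * D| ≤ |A| + |2 * β * B| + |β ^ 2 * D| := abs_add_three _ _ _
      _ ≤ _ := by linarith
  have hc : ContinuousOn (fun β => 2 * β + ε * (A + 2 * β * B + β ^ 2 * D)) (Icc (-η) η) := by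
    fun_prop
  have h1 := abs_le.1 (hbd (-η) (by rw [abs_neg, abs_of_pos hη0]))
  have h2 := abs_le.1 (hbd η (by rw [abs_of_pos hη0]))
  obtain ⟨β, hβ, e⟩ := intermediate_value_Icc (show -η ≤ η by linarith) hc
    (show (0 : ℝ) ∈ _ from ⟨by linarith, by linarith⟩)
  exact ⟨β, abs_le.2 hβ, e⟩

/-- A graph whose length has a nonzero first variation under the constraints `∫ G w`, `∫ G² w`
is not longest. -/
theorem exists_longer_of_first_variation {T M : ℝ} (hT : 0 < T) {G w v φ ψ φ' ψ' : ℝ → ℝ}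
    (hG : Continuous G) (hw : Continuous w) (hφ : Continuous φ) (hψ : Continuous ψ)
    (hv : IntervalIntegrable v volume 0 T) (hφ' : Continuous φ') (hψ' : Continuous ψ')
    (hwv : ∀ t, w t ^ 2 - v t ^ 2 = 1)
    (hvM : ∀ t ∈ Icc 0 T, |v t| ≤ M) (hφM : ∀ t ∈ Icc 0 T, |φ' t| ≤ M)
    (hψM : ∀ t ∈ Icc 0 T, |ψ' t| ≤ M)
    (hφ₁ : ∫ t in (0 : ℝ)..T, φ t * w t = 0) (hφ₂ : ∫ t in (0 : ℝ)..T, φ t * (G t * w t) = 0)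
    (hψ₁ : ∫ t in (0 : ℝ)..T, ψ t * w t = 0) (hψ₂ : ∫ t in (0 : ℝ)..T, ψ t * (G t * w t) = 1)
    (hvar : ∫ t in (0 : ℝ)..T, v t * φ' t < 0) :
    ∃ x y : ℝ, (∫ t in (0 : ℝ)..T, (G t + (x * φ t + y * ψ t)) * w t =
        ∫ t in (0 : ℝ)..T, G t * w t) ∧
      (∫ t in (0 : ℝ)..T, (G t + (x * φ t + y * ψ t)) ^ 2 * w t =
        ∫ t in (0 : ℝ)..T, G t ^ 2 * w t) ∧
      (∀ t ∈ Icc 0 T, (v t + (x * φ' t + y * ψ' t)) ^ 2 < w t ^ 2) ∧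
      T < ∫ t in (0 : ℝ)..T, Real.sqrt (w t ^ 2 - (v t + (x * φ' t + y * ψ' t)) ^ 2) := by
  have hM : 0 ≤ M := (abs_nonneg _).trans (hvM 0 ⟨le_rfl, hT.le⟩)
  set A := ∫ t in (0 : ℝ)..T, φ t ^ 2 * w t with hA
  set B := ∫ t in (0 : ℝ)..T, φ t * ψ t * w t with hB
  set D := ∫ t in (0 : ℝ)..T, ψ t ^ 2 * w t with hD
  set p := -∫ t in (0 : ℝ)..T, v t * φ' t with hp
  set r := ∫ t in (0 : ℝ)..T, v t * ψ' t with hr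
  have hp0 : 0 < p := by linarith
  obtain ⟨η, hη0, hη1, hηr⟩ : ∃ η : ℝ, 0 < η ∧ η ≤ 1 ∧ η * |r| ≤ p / 4 := by
    refine ⟨min 1 (p / 4 / (|r| + 1)), by positivity, min_le_left _ _, ?_⟩
    calc min 1 (p / 4 / (|r| + 1)) * |r| ≤ p / 4 / (|r| + 1) * (|r| + 1) := by
          gcongr
          · exact min_le_right _ _
          · linarith
      _ = p / 4 := by field_simp
  set Q := T * (2 * M ^ 2 + 64 * M ^ 4) with hQ
  have hQ0 : 0 ≤ Q := by positivity
  obtain ⟨ε, hε0, hε⟩ := exists_small_parameter ![1, 8 * M ^ 2, Q, |A| + 2 * |B| + |D|]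
    ![1, 1 / 2, p / 4, η] (by
      intro i; fin_cases i
      · exact one_pos
      · exact one_half_pos
      · exact div_pos hp0 four_pos
      · exact hη0)
  have hε1 : ε * 1 ≤ 1 := hε 0
  have hεM : ε * (8 * M ^ 2) ≤ 1 / 2 := hε 1
  have hεQ : ε * Q ≤ p / 4 := hε 2
  have hεη : ε * (|A| + 2 * |B| + |D|) ≤ η := hε 3
  obtain ⟨β, hβ, hβ0⟩ := exists_root_near_zero hε0 hη0 hη1 hεη
  have hβ1 : |β| ≤ 1 := hβ.trans hη1
  have hd : ∀ t ∈ Icc 0 T, |ε * φ' t + ε * β * ψ' t| ≤ 2 * ε * M := by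
    intro t ht
    calc |ε * φ' t + ε * β * ψ' t| ≤ |ε * φ' t| + |ε * β * ψ' t| := abs_add_le _ _
      _ = ε * |φ' t| + ε * (|β| * |ψ' t|) := by
        rw [abs_mul, abs_mul, abs_mul, abs_of_pos hε0]; ring
      _ ≤ ε * M + ε * (1 * M) := by
        have := hφM t ht
        have := hψM t ht
        gcongr
      _ = _ := by ring
  have hlow := fun t ht => sub_le_sqrt_of_abs_le hM hε0 (by linarith) (by linarith) (hwv t)
    (hvM t ht) (hd t ht)
  have hvφ : IntervalIntegrable (fun t => v t * φ' t) volume 0 T :=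
    hv.mul_continuousOn hφ'.continuousOn
  have hvψ : IntervalIntegrable (fun t => v t * ψ' t) volume 0 T :=
    hv.mul_continuousOn hψ'.continuousOn
  refine ⟨ε, ε * β, ?_, ?_, ?_, ?_⟩
  · have e : ∀ t, (G t + (ε * φ t + ε * β * ψ t)) * w t =
        G t * w t + (ε * (φ t * w t) + ε * β * (ψ t * w t)) := fun t => by ring
    simp only [e]
    rw [intervalIntegral.integral_add, intervalIntegral.integral_add,
      intervalIntegral.integral_const_mul, intervalIntegral.integral_const_mul, hφ₁, hψ₁]
    · ring
    all_goals exact Continuous.intervalIntegrable (by fun_prop) _ _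
  · have e : ∀ t, (G t + (ε * φ t + ε * β * ψ t)) ^ 2 * w t =
        G t ^ 2 * w t + (2 * ε * (φ t * (G t * w t)) + (2 * ε * β * (ψ t * (G t * w t)) +
          (ε ^ 2 * (φ t ^ 2 * w t) + (2 * ε ^ 2 * β * (φ t * ψ t * w t) +
            ε ^ 2 * β ^ 2 * (ψ t ^ 2 * w t))))) := fun t => by ring
    simp only [e]
    rw [intervalIntegral.integral_add, intervalIntegral.integral_add,
      intervalIntegral.integral_add, intervalIntegral.integral_add, intervalIntegral.integral_add,
      intervalIntegral.integral_const_mul, intervalIntegral.integral_const_mul,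
      intervalIntegral.integral_const_mul, intervalIntegral.integral_const_mul,
      intervalIntegral.integral_const_mul, hφ₂, hψ₂, ← hA, ← hB, ← hD]
    · linear_combination ε * hβ0
    all_goals exact Continuous.intervalIntegrable (by fun_prop) _ _
  · exact fun t ht => (hlow t ht).1
  · have hint : ∫ t in (0 : ℝ)..T, (1 - v t * (ε * φ' t + ε * β * ψ' t) -
        ε ^ 2 * (2 * M ^ 2 + 64 * M ^ 4)) = T + ε * p - ε * β * r - ε * (ε * Q) := by
      have e : ∀ t, 1 - v t * (ε * φ' t + ε * β * ψ' t) - ε ^ 2 * (2 * M ^ 2 + 64 * M ^ 4) =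
          (1 - ε ^ 2 * (2 * M ^ 2 + 64 * M ^ 4)) + ((-ε) * (v t * φ' t) +
            (-(ε * β)) * (v t * ψ' t)) := fun t => by ring
      simp only [e]
      rw [intervalIntegral.integral_add (by simp) ((hvφ.const_mul _).add (hvψ.const_mul _)),
        intervalIntegral.integral_add (hvφ.const_mul _) (hvψ.const_mul _),
        intervalIntegral.integral_const_mul, intervalIntegral.integral_const_mul,
        intervalIntegral.integral_const, ← hr, hp, hQ]
      simp only [smul_eq_mul]
      ring
    have hge : ∫ t in (0 : ℝ)..T, (1 - v t * (ε * φ' t + ε * β * ψ' t) -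
        ε ^ 2 * (2 * M ^ 2 + 64 * M ^ 4)) ≤
        ∫ t in (0 : ℝ)..T, Real.sqrt (w t ^ 2 - (v t + (ε * φ' t + ε * β * ψ' t)) ^ 2) := by
      refine intervalIntegral.integral_mono_on hT.le ?_ ?_ fun t ht => (hlow t ht).2
      · have hd' : Continuous fun t => ε * φ' t + ε * β * ψ' t := by fun_prop
        exact (intervalIntegrable_const.sub (hv.mul_continuousOn hd'.continuousOn)).sub
          intervalIntegrable_const
      · have hd' : Continuous fun t => ε * φ' t + ε * β * ψ' t := by fun_prop
        refine (hw.intervalIntegrable 0 T).mono_fun ?_ (Filter.Eventually.of_forall fun t => ?_)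
        · have h1 := hv.def'.aestronglyMeasurable.add hd'.aestronglyMeasurable
          have h2 := ((hw.pow 2).aestronglyMeasurable.sub (h1.pow 2))
          exact Real.continuous_sqrt.comp_aestronglyMeasurable h2
        · beta_reduce
          rw [Real.norm_of_nonneg (Real.sqrt_nonneg _), Real.norm_eq_abs]
          exact Real.sqrt_le_iff.2 ⟨abs_nonneg _, by rw [sq_abs]; linarith [sq_nonneg (v t +
            (ε * φ' t + ε * β * ψ' t))]⟩
    rw [hint] at hge
    refine lt_of_lt_of_le ?_ hge
    have h1 : β * r ≤ p / 4 := by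
      calc β * r ≤ |β * r| := le_abs_self _
        _ = |β| * |r| := abs_mul _ _
        _ ≤ η * |r| := by gcongr
        _ ≤ _ := hηr
    have h2 : 0 < ε * (p - β * r - ε * Q) := mul_pos hε0 (by linarith)
    linarith

/-- The function `f` with its restriction to `[a, b]` read backwards. -/
def reverseOn (a b : ℝ) (f : ℝ → ℝ) (t : ℝ) : ℝ := if t ∈ Icc a b then f (a + b - t) else f t

theorem reverseOn_of_mem {a b t : ℝ} (f : ℝ → ℝ) (h : t ∈ Icc a b) :
    reverseOn a b f t = f (a + b - t) := if_pos h

theorem reverseOn_of_lt {a b t : ℝ} (f : ℝ → ℝ) (h : t < a) : reverseOn a b f t = f t :=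
  if_neg fun h' => h.not_ge h'.1

theorem reverseOn_of_gt {a b t : ℝ} (f : ℝ → ℝ) (h : b < t) : reverseOn a b f t = f t :=
  if_neg fun h' => h.not_ge h'.2

theorem reverseOn_of_le {a b t : ℝ} {f : ℝ → ℝ} (hab : a ≤ b) (hf : f a = f b) (h : t ≤ a) :
    reverseOn a b f t = f t := by
  rcases h.lt_or_eq with h | rfl
  · exact reverseOn_of_lt f h
  · rw [reverseOn_of_mem f ⟨le_rfl, hab⟩, hf]; congr 1; ring

theorem reverseOn_of_ge {a b t : ℝ} {f : ℝ → ℝ} (hab : a ≤ b) (hf : f a = f b) (h : b ≤ t) :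
    reverseOn a b f t = f t := by
  rcases h.lt_or_eq with h | rfl
  · exact reverseOn_of_gt f h
  · rw [reverseOn_of_mem f ⟨hab, le_rfl⟩, ← hf]; congr 1; ring

theorem continuous_reverseOn {a b : ℝ} {f : ℝ → ℝ} (hab : a ≤ b) (hf : f a = f b)
    (hc : Continuous f) : Continuous (reverseOn a b f) := by
  have h : reverseOn a b f = fun t => if t ≤ a then f t else if t ≤ b then f (a + b - t) else
      f t := by
    funext t
    split_ifs with h1 h2
    · exact reverseOn_of_le hab hf h1
    · exact reverseOn_of_mem f ⟨(not_le.1 h1).le, h2⟩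
    · exact reverseOn_of_gt f (not_le.1 h2)
  rw [h]
  refine Continuous.if_le hc ?_ continuous_id continuous_const ?_
  · refine Continuous.if_le (by fun_prop) hc continuous_id continuous_const ?_
    rintro t rfl
    rw [← hf]; congr 1; ring
  · rintro t rfl
    rw [if_pos hab, hf]; congr 1; ring

theorem lipschitzOnWith_reverseOn {a b S : ℝ} {f : ℝ → ℝ} (ha : 0 ≤ a) (hab : a ≤ b) (hb : b ≤ S)
    (hf : f a = f b) {K : NNReal} (h : LipschitzOnWith K f (Icc 0 S)) :
    LipschitzOnWith K (reverseOn a b f) (Icc 0 S) := by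
  rw [lipschitzOnWith_iff_dist_le_mul] at h ⊢
  have key : ∀ x ∈ Icc 0 S, ∀ y ∈ Icc 0 S, x ≤ y →
      dist (reverseOn a b f x) (reverseOn a b f y) ≤ K * dist x y := by
    intro x hx y hy hxy
    have hM : ∀ s ∈ Icc 0 S, ∀ t ∈ Icc 0 S, |f s - f t| ≤ K * |s - t| := h
    rw [Real.dist_eq, Real.dist_eq]
    rcases le_or_gt x a with hxa | hxa
    · rw [reverseOn_of_le hab hf hxa]
      rcases le_or_gt y a with hya | hya
      · rw [reverseOn_of_le hab hf hya]; exact hM x hx y hy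
      rcases le_or_gt y b with hyb | hyb
      · rw [reverseOn_of_mem f ⟨hya.le, hyb⟩]
        have h1 := hM x hx a ⟨ha, hab.trans hb⟩
        have h2 := hM b ⟨ha.trans hab, hb⟩ (a + b - y) ⟨by linarith, by linarith⟩
        rw [← hf] at h2
        have h3 := abs_sub_le (f x) (f a) (f (a + b - y))
        rw [abs_of_nonpos (by linarith : x - a ≤ 0)] at h1
        rw [abs_of_nonneg (by linarith : 0 ≤ b - (a + b - y))] at h2
        rw [abs_of_nonpos (by linarith : x - y ≤ 0)]
        linarith
      · rw [reverseOn_of_gt f hyb]; exact hM x hx y hy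
    rcases le_or_gt x b with hxb | hxb
    · rw [reverseOn_of_mem f ⟨hxa.le, hxb⟩]
      rcases le_or_gt y b with hyb | hyb
      · rw [reverseOn_of_mem f ⟨hxa.le.trans hxy, hyb⟩]
        refine (hM _ ⟨by linarith, by linarith⟩ _ ⟨by linarith, by linarith⟩).trans_eq ?_
        rw [abs_sub_comm x y]; congr 2; ring
      · rw [reverseOn_of_gt f hyb]
        have h1 := hM (a + b - x) ⟨by linarith, by linarith⟩ a ⟨ha, hab.trans hb⟩
        have h2 := hM b ⟨ha.trans hab, hb⟩ y hy
        rw [← hf] at h2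
        have h3 := abs_sub_le (f (a + b - x)) (f a) (f y)
        rw [abs_of_nonneg (by linarith : 0 ≤ a + b - x - a)] at h1
        rw [abs_of_nonpos (by linarith : b - y ≤ 0)] at h2
        rw [abs_of_nonpos (by linarith : x - y ≤ 0)]
        linarith
    · rw [reverseOn_of_gt f hxb, reverseOn_of_gt f (hxb.trans_le hxy)]
      exact hM x hx y hy
  intro x hx y hy
  rcases le_total x y with hxy | hxy
  · exact key x hx y hy hxy
  · rw [dist_comm, dist_comm x]; exact key y hy x hx hxy

theorem integral_reverseOn {a b S : ℝ} {f : ℝ → ℝ} (ha : 0 ≤ a) (hab : a ≤ b) (hb : b ≤ S)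
    (hf : f a = f b) (hc : Continuous f) :
    ∫ t in (0 : ℝ)..S, reverseOn a b f t = ∫ t in (0 : ℝ)..S, f t := by
  have hr := continuous_reverseOn hab hf hc
  rw [← intervalIntegral.integral_add_adjacent_intervals (hr.intervalIntegrable 0 a)
    (hr.intervalIntegrable a S), ← intervalIntegral.integral_add_adjacent_intervals
    (hr.intervalIntegrable a b) (hr.intervalIntegrable b S),
    ← intervalIntegral.integral_add_adjacent_intervals (hc.intervalIntegrable 0 a)
    (hc.intervalIntegrable a S), ← intervalIntegral.integral_add_adjacent_intervals
    (hc.intervalIntegrable a b) (hc.intervalIntegrable b S)]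
  congr 1
  · refine intervalIntegral.integral_congr fun t ht => ?_
    rw [uIcc_of_le ha] at ht
    exact reverseOn_of_le hab hf ht.2
  congr 1
  · have : ∫ t in a..b, reverseOn a b f t = ∫ t in a..b, f (a + b - t) := by
      refine intervalIntegral.integral_congr fun t ht => ?_
      rw [uIcc_of_le hab] at ht
      exact reverseOn_of_mem f ht
    rw [this, intervalIntegral.integral_comp_sub_left]
    congr 1 <;> ring
  · refine intervalIntegral.integral_congr fun t ht => ?_
    rw [uIcc_of_le hb] at ht
    exact reverseOn_of_ge hab hf ht.1

/-- The derivative of `reverseOn a b f` off `{a, b}`, for `f` with derivative `f'`. -/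
def reverseOnDeriv (a b : ℝ) (f' : ℝ → ℝ) (t : ℝ) : ℝ :=
  if t ∈ Icc a b then -f' (a + b - t) else f' t

theorem hasDerivAt_reverseOn {a b t : ℝ} {f f' : ℝ → ℝ} (hf : ∀ t, HasDerivAt f (f' t) t)
    (ha : t ≠ a) (hb : t ≠ b) :
    HasDerivAt (reverseOn a b f) (reverseOnDeriv a b f' t) t := by
  by_cases h : t ∈ Icc a b
  · have hI : t ∈ Ioo a b := ⟨lt_of_le_of_ne h.1 ha.symm, lt_of_le_of_ne h.2 hb⟩
    rw [reverseOnDeriv, if_pos h]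
    have h1 : HasDerivAt (fun s => f (a + b - s)) (-f' (a + b - t)) t := 
      (hf (a + b - t)).comp_const_sub (a + b) t
    refine h1.congr_of_eventuallyEq ?_
    filter_upwards [isOpen_Ioo.mem_nhds hI] with s hs
    exact reverseOn_of_mem f (Ioo_subset_Icc_self hs)
  · rw [reverseOnDeriv, if_neg h]
    refine (hf t).congr_of_eventuallyEq ?_
    filter_upwards [isClosed_Icc.isOpen_compl.mem_nhds h] with s hs
    exact if_neg hs

theorem reverseOnDeriv_sq (a b : ℝ) (f' : ℝ → ℝ) (t : ℝ) :
    reverseOnDeriv a b f' t ^ 2 = reverseOn a b f' t ^ 2 := by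
  unfold reverseOnDeriv reverseOn
  split_ifs <;> ring

theorem measurable_reverseOnDeriv {a b : ℝ} {f' : ℝ → ℝ} (hc : Continuous f') :
    Measurable (reverseOnDeriv a b f') :=
  Measurable.ite measurableSet_Icc (by fun_prop) hc.measurable

theorem exists_bound_reverseOnDeriv {a b S : ℝ} {f' : ℝ → ℝ} (ha : 0 ≤ a) (hb : b ≤ S)
    (hc : Continuous f') : ∃ M, ∀ t ∈ Icc 0 S, |reverseOnDeriv a b f' t| ≤ M := by
  obtain ⟨M, hM⟩ := isCompact_Icc.exists_bound_of_continuousOn (s := Icc 0 S) hc.continuousOn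
  refine ⟨M, fun t ht => ?_⟩
  unfold reverseOnDeriv
  split_ifs with h
  · rw [abs_neg]
    exact hM _ ⟨by linarith [h.2], by linarith [h.1]⟩
  · exact hM t ht

theorem intervalIntegrable_reverseOnDeriv {a b S : ℝ} {f' : ℝ → ℝ} (ha : 0 ≤ a) (hb : b ≤ S)
    (hS : 0 ≤ S) (hc : Continuous f') :
    IntervalIntegrable (reverseOnDeriv a b f') volume 0 S := by
  obtain ⟨M, hM⟩ := exists_bound_reverseOnDeriv ha hb hc
  refine (intervalIntegrable_const (c := M)).mono_fun
    (measurable_reverseOnDeriv hc).aestronglyMeasurable ?_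
  rw [uIoc_of_le hS]
  filter_upwards [ae_restrict_mem measurableSet_Ioc] with t ht
  exact (hM t (Ioc_subset_Icc_self ht)).trans (le_abs_self M)

/-- Integration by parts for a function with reversed middle part. -/
theorem integral_reverseOnDeriv_mul_deriv {a b S : ℝ} (ha : 0 ≤ a) (hab : a ≤ b) (hb : b ≤ S)
    {g g' φ φ' : ℝ → ℝ} (hg : ∀ t, HasDerivAt g (g' t) t) (hg' : Continuous g')
    (hφ : ∀ t, HasDerivAt φ (φ' t) t) (hφ' : Continuous φ') (h0 : φ 0 = 0) (hS : φ S = 0)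
    (hgab : g a = g b) (hgab' : g' a = g' b) :
    ∫ t in (0 : ℝ)..S, reverseOnDeriv a b g t * φ' t =
      2 * g a * (φ a - φ b) - ∫ t in (0 : ℝ)..S, reverseOn a b g' t * φ t := by
  have hgc : Continuous g := continuous_iff_continuousAt.2 fun t => (hg t).continuousAt
  have hφc : Continuous φ := continuous_iff_continuousAt.2 fun t => (hφ t).continuousAt
  have hr := continuous_reverseOn hab hgab' hg'
  have hint := (intervalIntegrable_reverseOnDeriv ha hb (ha.trans (hab.trans hb)) hgc).mul_continuousOn
    hφ'.continuousOn
  have hi : ∀ x y, x ∈ Icc 0 S → y ∈ Icc 0 S →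
      IntervalIntegrable (fun t => reverseOnDeriv a b g t * φ' t) volume x y := fun x y hx hy =>
    hint.mono_set (by
      rw [uIcc_of_le (ha.trans (hab.trans hb))]
      exact uIcc_subset_Icc hx hy)
  have h0S : (0 : ℝ) ∈ Icc 0 S := ⟨le_rfl, ha.trans (hab.trans hb)⟩
  have haS : a ∈ Icc 0 S := ⟨ha, hab.trans hb⟩
  have hbS : b ∈ Icc 0 S := ⟨ha.trans hab, hb⟩
  have hSS : S ∈ Icc 0 S := ⟨h0S.2, le_rfl⟩
  have hrφ : Continuous fun t => reverseOn a b g' t * φ t := hr.mul hφc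
  rw [← intervalIntegral.integral_add_adjacent_intervals (hi 0 a h0S haS) (hi a S haS hSS),
    ← intervalIntegral.integral_add_adjacent_intervals (hi a b haS hbS) (hi b S hbS hSS),
    ← intervalIntegral.integral_add_adjacent_intervals (hrφ.intervalIntegrable 0 a)
    (hrφ.intervalIntegrable a S), ← intervalIntegral.integral_add_adjacent_intervals
    (hrφ.intervalIntegrable a b) (hrφ.intervalIntegrable b S)]
  have hne : ∀ c : ℝ, ∀ᵐ t : ℝ, t ≠ c := fun c => by
    simp [ae_iff]
  have e1 : ∫ t in (0 : ℝ)..a, reverseOnDeriv a b g t * φ' t = ∫ t in (0 : ℝ)..a, g t * φ' t := by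
    refine intervalIntegral.integral_congr_ae ?_
    filter_upwards [hne a] with t ht hta
    rw [uIoc_of_le ha] at hta
    rw [reverseOnDeriv, if_neg fun h => ht (le_antisymm hta.2 h.1)]
  have e2 : ∫ t in a..b, reverseOnDeriv a b g t * φ' t =
      ∫ t in a..b, -g (a + b - t) * φ' t := by
    refine intervalIntegral.integral_congr fun t ht => ?_
    rw [uIcc_of_le hab] at ht
    simp only [reverseOnDeriv, if_pos ht]
  have e3 : ∫ t in b..S, reverseOnDeriv a b g t * φ' t = ∫ t in b..S, g t * φ' t := by
    refine intervalIntegral.integral_congr_ae ?_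
    filter_upwards with t ht
    rw [uIoc_of_le hb] at ht
    rw [reverseOnDeriv, if_neg fun h => ht.1.not_ge h.2]
  have f1 : ∫ t in (0 : ℝ)..a, reverseOn a b g' t * φ t = ∫ t in (0 : ℝ)..a, g' t * φ t := by
    refine intervalIntegral.integral_congr fun t ht => ?_
    rw [uIcc_of_le ha] at ht
    simp only [reverseOn_of_le hab hgab' ht.2]
  have f2 : ∫ t in a..b, reverseOn a b g' t * φ t = ∫ t in a..b, g' (a + b - t) * φ t := by
    refine intervalIntegral.integral_congr fun t ht => ?_
    rw [uIcc_of_le hab] at ht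
    simp only [reverseOn_of_mem g' ht]
  have f3 : ∫ t in b..S, reverseOn a b g' t * φ t = ∫ t in b..S, g' t * φ t := by
    refine intervalIntegral.integral_congr fun t ht => ?_
    rw [uIcc_of_le hb] at ht
    simp only [reverseOn_of_ge hab hgab' ht.1]
  have p1 := intervalIntegral.integral_mul_deriv_eq_deriv_mul (a := 0) (b := a)
    (fun t _ => hg t) (fun t _ => hφ t) (hg'.intervalIntegrable _ _) (hφ'.intervalIntegrable _ _)
  have p2 := intervalIntegral.integral_mul_deriv_eq_deriv_mul (a := a) (b := b)
    (u := fun t => -g (a + b - t)) (u' := fun t => g' (a + b - t))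
    (fun t _ => ((hg (a + b - t)).comp_const_sub (a + b) t).fun_neg.congr_deriv (neg_neg _))
    (fun t _ => hφ t) ((by fun_prop : Continuous fun t => g' (a + b - t)).intervalIntegrable _ _)
    (hφ'.intervalIntegrable _ _)
  have p3 := intervalIntegral.integral_mul_deriv_eq_deriv_mul (a := b) (b := S)
    (fun t _ => hg t) (fun t _ => hφ t) (hg'.intervalIntegrable _ _) (hφ'.intervalIntegrable _ _)
  rw [e1, e2, e3, f1, f2, f3, p1, p2, p3, h0, hS, add_sub_cancel_left, add_sub_cancel_right, hgab]
  ring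

/-- The horizontal curve with first coordinate `G` and with the derivative `w` of the second
coordinate. -/
def lift (G w : ℝ → ℝ) (t : ℝ) : Vec4 :=
  ![G t, ∫ s in (0 : ℝ)..t, w s,
    (∫ s in (0 : ℝ)..t, G s * w s) - G t * (∫ s in (0 : ℝ)..t, w s) / 2,
    (∫ s in (0 : ℝ)..t, G s ^ 2 * w s) / 2 + (∫ s in (0 : ℝ)..t, w s) ^ 3 / 6]

theorem hasDerivAt_lift {G w : ℝ → ℝ} (hG : Continuous G) (hw : Continuous w) {g t : ℝ}
    (h : HasDerivAt G g t) :
    HasDerivAt (lift G w) (g • X1 (lift G w t) + w t • X2 (lift G w t)) t := by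
  have h1 : HasDerivAt (fun t => ∫ s in (0 : ℝ)..t, w s) (w t) t :=
    (hw.integral_hasStrictDerivAt 0 t).hasDerivAt
  have h2 : HasDerivAt (fun t => ∫ s in (0 : ℝ)..t, G s * w s) (G t * w t) t :=
    ((hG.mul hw).integral_hasStrictDerivAt 0 t).hasDerivAt
  have h3 : HasDerivAt (fun t => ∫ s in (0 : ℝ)..t, G s ^ 2 * w s) (G t ^ 2 * w t) t :=
    (((hG.pow 2).mul hw).integral_hasStrictDerivAt 0 t).hasDerivAt
  rw [hasDerivAt_pi]
  intro i
  fin_cases i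
  · simpa [lift, X1, X2] using h
  · simpa [lift, X1, X2] using h1
  · refine (h2.sub ((h.mul h1).div_const 2)).congr_deriv ?_
    simp [lift, X1, X2]; ring
  · refine ((h3.div_const 2).add ((h1.pow 3).div_const 6)).congr_deriv ?_
    simp [lift, X1, X2]; ring

theorem metric_field (u₁ u₂ : ℝ) (q : Vec4) :
    metric (u₁ • X1 q + u₂ • X2 q) (u₁ • X1 q + u₂ • X2 q) = u₂ ^ 2 - u₁ ^ 2 := by
  simp [metric, X1, X2]; ring

theorem metric_field_X2 (u₁ u₂ : ℝ) (q : Vec4) : metric (u₁ • X1 q + u₂ • X2 q) (X2 q) = u₂ := by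
  simp [metric, X1, X2]

theorem absolutelyContinuousOnInterval_vec4 {γ : ℝ → Vec4} {a b : ℝ}
    (h : ∀ i, AbsolutelyContinuousOnInterval (fun t => γ t i) a b) :
    AbsolutelyContinuousOnInterval γ a b := by
  have hc : ∀ v : Vec4, AbsolutelyContinuousOnInterval (fun _ : ℝ => v) a b := fun v =>
    (LipschitzWith.const v).lipschitzOnWith.absolutelyContinuousOnInterval
  have e : γ = (fun t => γ t 0) • (fun _ => (Pi.single 0 1 : Vec4)) +
      (fun t => γ t 1) • (fun _ => (Pi.single 1 1 : Vec4)) +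
      (fun t => γ t 2) • (fun _ => (Pi.single 2 1 : Vec4)) +
      (fun t => γ t 3) • (fun _ => (Pi.single 3 1 : Vec4)) := by
    funext t i
    fin_cases i <;> simp
  rw [e]
  exact ((((h 0).smul (hc _)).add ((h 1).smul (hc _))).add ((h 2).smul (hc _))).add
    ((h 3).smul (hc _))

theorem absolutelyContinuousOnInterval_lift {G w : ℝ → ℝ} (hG : Continuous G) (hw : Continuous w)
    {T : ℝ} (h : AbsolutelyContinuousOnInterval G 0 T) :
    AbsolutelyContinuousOnInterval (lift G w) 0 T := by
  have hI : ∀ f : ℝ → ℝ, Continuous f →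
      AbsolutelyContinuousOnInterval (fun t => ∫ s in (0 : ℝ)..t, f s) 0 T := fun f hf =>
    (contDiff_one_iff_deriv.2 ⟨fun t => (hf.integral_hasStrictDerivAt 0 t).hasDerivAt.differentiableAt, by
      simpa only [funext (hf.deriv_integral f 0)] using hf⟩).contDiffOn.absolutelyContinuousOnInterval
  refine absolutelyContinuousOnInterval_vec4 fun i => ?_
  have h1 := hI w hw
  have h2 := hI _ (hG.mul hw)
  have h3 := hI _ ((hG.pow 2).mul hw)
  fin_cases i
  · exact h
  · exact h1
  · have e : (fun t => lift G w t 2) = (fun t => ∫ s in (0 : ℝ)..t, G s * w s) -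
        (G * fun t => (1 / 2) * ∫ s in (0 : ℝ)..t, w s) := by
      funext t; simp [lift]; ring
    rw [show (fun t => lift G w t ⟨2, by norm_num⟩) = fun t => lift G w t 2 from rfl, e]
    exact h2.sub (h.mul (h1.const_mul _))
  · have e : (fun t => lift G w t 3) = (fun t => (1 / 2) * ∫ s in (0 : ℝ)..t, G s ^ 2 * w s) +
        (fun t => (1 / 6) * (∫ s in (0 : ℝ)..t, w s)) * ((fun t => ∫ s in (0 : ℝ)..t, w s) *
          fun t => ∫ s in (0 : ℝ)..t, w s) := by
      funext t; simp [lift]; ring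
    rw [show (fun t => lift G w t ⟨3, by norm_num⟩) = fun t => lift G w t 3 from rfl, e]
    exact (h3.const_mul _).add ((h1.const_mul _).mul (h1.mul h1))

theorem isSpacelikeFD_lift {G g w : ℝ → ℝ} (hG : Continuous G) (hw : Continuous w) {T : ℝ}
    (h : AbsolutelyContinuousOnInterval G 0 T) {s : Set ℝ} (hs : s.Countable)
    (hd : ∀ t, t ∉ s → HasDerivAt G (g t) t) (hlt : ∀ t ∈ Icc 0 T, g t ^ 2 < w t ^ 2)
    (hw0 : ∀ t, 0 < w t) : IsSpacelikeFD T (lift G w) := by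
  refine ⟨absolutelyContinuousOnInterval_lift hG hw h, ?_⟩
  filter_upwards [ae_restrict_mem measurableSet_Icc, ae_restrict_of_ae (hs.ae_notMem volume)]
    with t ht hts
  refine ⟨g t, w t, hasDerivAt_lift hG hw (hd t hts), ?_, ?_⟩
  · rw [metric_field]; linarith [hlt t ht]
  · rw [metric_field_X2]; exact hw0 t

theorem length_lift {G g w : ℝ → ℝ} (hG : Continuous G) (hw : Continuous w) {T : ℝ} (hT : 0 ≤ T)
    {s : Set ℝ} (hs : s.Countable) (hd : ∀ t, t ∉ s → HasDerivAt G (g t) t)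
    (hlt : ∀ t ∈ Icc 0 T, g t ^ 2 < w t ^ 2) :
    length T (lift G w) = ∫ t in (0 : ℝ)..T, Real.sqrt (w t ^ 2 - g t ^ 2) := by
  refine intervalIntegral.integral_congr_ae ?_
  filter_upwards [hs.ae_notMem volume] with t hts ht
  rw [uIoc_of_le hT] at ht
  rw [(hasDerivAt_lift hG hw (hd t hts)).deriv, metric_field,
    abs_of_nonneg (by linarith [hlt t (Ioc_subset_Icc_self ht)])]

theorem length_congr {T : ℝ} (hT : 0 ≤ T) {γ η : ℝ → Vec4} (h : EqOn γ η (Icc 0 T)) :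
    length T γ = length T η := by
  refine intervalIntegral.integral_congr_ae ?_
  have hne : ∀ᵐ t : ℝ, t ≠ T := by simp [ae_iff]
  filter_upwards [hne] with t ht htT
  rw [uIoc_of_le hT] at htT
  have : γ =ᶠ[nhds t] η := Filter.eventuallyEq_of_mem
    (Icc_mem_nhds htT.1 (lt_of_le_of_ne htT.2 ht)) h
  rw [this.deriv_eq]

theorem Covector.m1_lt_one {l : Covector} (hl : l ∈ C1) : l.m1 < 1 := by
  obtain ⟨h1, h2⟩ := hl
  unfold Covector.m1
  rw [div_lt_one (by linarith)]
  linarith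

theorem Covector.ae1_pos {l : Covector} (hl : l ∈ C1) : 0 < l.ae1 := by
  obtain ⟨h1, h2⟩ := hl
  exact Real.sqrt_pos.2 (by linarith)

theorem Covector.ae1_sq {l : Covector} (hl : l ∈ C1) : l.ae1 ^ 2 = (l.E - l.α) / 2 := by
  obtain ⟨h1, h2⟩ := hl
  exact Real.sq_sqrt (by linarith)

/-- The phase of a covector in `C₁`. -/
theorem exists_phase₁ {l : Covector} (hl : l ∈ C1) : ∃ x : ℝ,
    Real.sqrt (2 * (l.E + l.α)) * Real.sin x = l.c ∧
    -(Real.sqrt (2 * (l.E + l.α)) * l.ae1 / l.α) * (Real.cos x * delta l.m1 x) =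
      Real.sinh l.θ := by
  have hm := Covector.m1_lt_one hl
  have hr := Covector.ae1_pos hl
  have hr2 := Covector.ae1_sq hl
  obtain ⟨hα, hE0⟩ := hl
  have hE : l.E = l.c ^ 2 / 2 - l.α * Real.cosh l.θ := rfl
  have hmq : l.m1 * (l.E - l.α) = l.E + l.α := by
    have : l.E - l.α ≠ 0 := by linarith
    unfold Covector.m1; field_simp
  set C := Real.sqrt (2 * (l.E + l.α)) with hC
  have hC0 : 0 < C := Real.sqrt_pos.2 (by linarith)
  have hC2 : C ^ 2 = 2 * (l.E + l.α) := Real.sq_sqrt (by linarith)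
  have hw : |l.c / C| ≤ 1 := by
    rw [abs_div, abs_of_pos hC0, div_le_one hC0, ← sq_le_sq₀ (abs_nonneg _) hC0.le, sq_abs, hC2]
    nlinarith [Real.one_le_cosh l.θ]
  have hsin : Real.sin (Real.arcsin (l.c / C)) = l.c / C :=
    Real.sin_arcsin (abs_le.1 hw).1 (abs_le.1 hw).2
  have key : ∀ x, Real.sin x = l.c / C → 0 ≤ Real.cos x * Real.sinh l.θ →
      C * Real.sin x = l.c ∧ -(C * l.ae1 / l.α) * (Real.cos x * delta l.m1 x) =
        Real.sinh l.θ := by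
    intro x hx hs
    have h1 : C * Real.sin x = l.c := by rw [hx]; field_simp
    refine ⟨h1, ?_⟩
    have hB : 0 < -(C * l.ae1 / l.α) := by
      rw [← div_neg]; exact div_pos (mul_pos hC0 hr) (by linarith)
    have hD := delta_pos hm x
    have e : (-(C * l.ae1 / l.α) * (Real.cos x * delta l.m1 x)) ^ 2 = Real.sinh l.θ ^ 2 := by
      have hα' := hα.ne
      have h2 := congrArg (· ^ 2) h1
      simp only [mul_pow, hC2] at h2
      have hsc := Real.sin_sq_add_cos_sq x
      have hp2 : (l.E + l.α) * Real.cos x ^ 2 = l.α - l.α * Real.cosh l.θ := by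
        linear_combination (l.E + l.α) * hsc - (1 / 2) * h2 + hE
      rw [mul_pow, mul_pow, neg_sq, div_pow, mul_pow, hC2, hr2, delta_sq hm, Real.sinh_sq]
      field_simp
      have h3 : (l.E - l.α) * (1 - l.m1 * Real.sin x ^ 2) =
          -2 * l.α + (l.E + l.α) * Real.cos x ^ 2 := by
        linear_combination (-Real.sin x ^ 2) * hmq - (l.E + l.α) * hsc
      linear_combination ((l.E + l.α) * Real.cos x ^ 2) * h3 + ((l.E + l.α) * Real.cos x ^ 2 +
        (l.α - l.α * Real.cosh l.θ) - 2 * l.α) * hp2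
    rcases sq_eq_sq_iff_eq_or_eq_neg.1 e with h | h
    · exact h
    · have h4 : Real.cos x * Real.sinh l.θ =
          -(-(C * l.ae1 / l.α) * delta l.m1 x * Real.cos x ^ 2) := by
        rw [← neg_eq_iff_eq_neg.2 h]; ring
      have h5 : 0 < -(C * l.ae1 / l.α) * delta l.m1 x := mul_pos hB hD
      have h6 : Real.cos x = 0 := by
        by_contra h0
        have : 0 < Real.cos x ^ 2 := by positivity
        nlinarith
      rw [h6] at h ⊢
      linarith
  rcases le_total 0 (Real.sinh l.θ) with h | h
  · exact ⟨_, key _ hsin (mul_nonneg (Real.cos_arcsin_nonneg _) h)⟩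
  · refine ⟨_, key (Real.pi - Real.arcsin (l.c / C)) (by rw [Real.sin_pi_sub, hsin]) ?_⟩
    rw [Real.cos_pi_sub, neg_mul, ← mul_neg]
    exact mul_nonneg (Real.cos_arcsin_nonneg _) (by linarith)

/-- The vertical part of the extremals of `C₁` is periodic. -/
theorem exists_periodic_vertical {l : Covector} (hl : l ∈ C1) : ∃ h₁ h₂ h₃ : ℝ → ℝ,
    (∀ t, HasDerivAt h₁ (-(h₂ t * h₃ t)) t) ∧ (∀ t, HasDerivAt h₂ (-(h₁ t * h₃ t)) t) ∧
    (∀ t, HasDerivAt h₃ (-(l.α * h₁ t)) t) ∧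
    h₁ 0 = Real.sinh l.θ ∧ h₂ 0 = Real.cosh l.θ ∧ h₃ 0 = l.c ∧
    (∀ t, h₁ (t + 4 * ellipticK l.m1 / l.ae1) = h₁ t) ∧
    (∀ t, h₂ (t + 4 * ellipticK l.m1 / l.ae1) = h₂ t) ∧
    (∀ t, h₃ (t + 4 * ellipticK l.m1 / l.ae1) = h₃ t) ∧
    (∀ t, h₂ t ^ 2 - h₁ t ^ 2 = 1) ∧ (∀ t, 0 < h₂ t) ∧
    ∀ ε > 0, ∃ a ∈ Ioo 0 ε, h₁ a ≠ 0 := by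
  obtain ⟨x₀, hc, hs⟩ := exists_phase₁ hl
  have hm := Covector.m1_lt_one hl
  have hr := Covector.ae1_pos hl
  have hr2 := Covector.ae1_sq hl
  obtain ⟨hα, hE0⟩ := hl
  have hα' := hα.ne
  have hmq : l.m1 * (l.E - l.α) = l.E + l.α := by
    have : l.E - l.α ≠ 0 := by linarith
    unfold Covector.m1; field_simp
  have hmr : l.m1 * l.ae1 ^ 2 = (l.E + l.α) / 2 := by rw [hr2]; linarith
  have hC0 : 0 < Real.sqrt (2 * (l.E + l.α)) := Real.sqrt_pos.2 (by linarith)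
  have hC2 : Real.sqrt (2 * (l.E + l.α)) ^ 2 = 2 * (l.E + l.α) := Real.sq_sqrt (by linarith)
  generalize Real.sqrt (2 * (l.E + l.α)) = C at *
  set r := l.ae1
  set m := l.m1
  set k₁ : ℝ → ℝ := fun x => -(C * r / l.α) * (Real.cos x * delta m x) with hk₁
  set k₂ : ℝ → ℝ := fun x => 1 - (l.E + l.α) / l.α * Real.cos x ^ 2 with hk₂
  set k₃ : ℝ → ℝ := fun x => C * Real.sin x with hk₃
  have hk : ∀ x, k₂ x ^ 2 - k₁ x ^ 2 = 1 := by
    intro x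
    have hD2 := delta_sq hm x
    have hsc := Real.sin_sq_add_cos_sq x
    simp only [hk₁, hk₂, mul_pow, neg_sq, div_pow, hC2, hr2, hD2]
    field_simp
    linear_combination ((l.E + l.α) * Real.cos x ^ 2) *
      (Real.sin x ^ 2 * hmq + (l.E + l.α) * hsc)
  have hk₂0 : ∀ x, 0 < k₂ x := by
    intro x
    have : (l.E + l.α) / l.α ≤ 0 := div_nonpos_of_nonneg_of_nonpos (by linarith) hα.le
    simp only [hk₂]
    nlinarith [sq_nonneg (Real.cos x)]
  set φ : ℝ → ℝ := fun t => am m (ellipticF m x₀ + r * t) with hφ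
  have hφ' : ∀ t, HasDerivAt φ (r * delta m (φ t)) t := hasDerivAt_am_linear hm _ r
  have hφ0 : φ 0 = x₀ := by simp [hφ, am_ellipticF hm]
  have hφp : ∀ t, φ (t + 4 * ellipticK m / r) = φ t + 2 * Real.pi := by
    intro t
    rw [hφ]
    simp only
    rw [← am_add_four_mul_ellipticK hm]
    congr 1
    field_simp
    ring
  have hd₁ : ∀ t, HasDerivAt (fun t => k₁ (φ t)) (-(k₂ (φ t) * k₃ (φ t))) t := by
    intro t
    have hD := (delta_pos hm (φ t)).ne'
    have hD2 := delta_sq hm (φ t)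
    have hsc := Real.sin_sq_add_cos_sq (φ t)
    have h := ((((Real.hasDerivAt_cos (φ t)).mul (hasDerivAt_delta hm (φ t))).const_mul
      (-(C * r / l.α))).comp t (hφ' t))
    refine h.congr_deriv ?_
    simp only [hk₂, hk₃]
    field_simp
    linear_combination Real.sin (φ t) * (r ^ 2 * hD2 - m * r ^ 2 * hsc + hr2 +
      (2 * Real.cos (φ t) ^ 2 - 1) * hmr)
  have hd₂ : ∀ t, HasDerivAt (fun t => k₂ (φ t)) (-(k₁ (φ t) * k₃ (φ t))) t := by
    intro t
    have h := (((((Real.hasDerivAt_cos (φ t)).fun_pow 2).const_mul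
      ((l.E + l.α) / l.α)).const_sub 1).comp t (hφ' t))
    refine h.congr_deriv ?_
    simp only [hk₁, hk₃]
    field_simp
    norm_num
    linear_combination (-(Real.cos (φ t) * Real.sin (φ t) * delta m (φ t))) * hC2
  have hd₃ : ∀ t, HasDerivAt (fun t => k₃ (φ t)) (-(l.α * k₁ (φ t))) t := by
    intro t
    have h := (((Real.hasDerivAt_sin (φ t)).const_mul C).comp t (hφ' t))
    refine h.congr_deriv ?_
    simp only [hk₁]
    field_simp
  refine ⟨fun t => k₁ (φ t), fun t => k₂ (φ t), fun t => k₃ (φ t), hd₁, hd₂, hd₃, ?_, ?_, ?_,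
    fun t => ?_, fun t => ?_, fun t => ?_, fun t => hk _, fun t => hk₂0 _, ?_⟩
  · simp only [hφ0]; exact hs
  · simp only [hφ0]
    refine (pow_left_inj₀ (hk₂0 _).le (Real.cosh_pos _).le two_ne_zero).1 ?_
    rw [Real.cosh_sq, ← hs]
    linarith [hk x₀]
  · simp only [hφ0]; exact hc
  · simp only [hk₁, hφp, two_mul, ← add_assoc, delta_add_pi, Real.cos_add_pi,
      neg_neg]
  · simp only [hk₂, hφp, Real.cos_add_two_pi]
  · simp only [hk₃, hφp, Real.sin_add_two_pi]
  · intro ε hε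
    by_contra! h
    have ht : ε / 2 ∈ Ioo 0 ε := ⟨by linarith, by linarith⟩
    have h1 := h _ ht
    have h2 : HasDerivAt (fun t => k₁ (φ t)) 0 (ε / 2) :=
      (hasDerivAt_const (ε / 2) (0 : ℝ)).congr_of_eventuallyEq
        (Filter.eventuallyEq_of_mem (isOpen_Ioo.mem_nhds ht) h)
    have h3 := neg_eq_zero.1 ((hd₁ (ε / 2)).unique h2)
    have h4 := (mul_eq_zero.1 h3).resolve_left (hk₂0 _).ne'
    have h5 : Real.sin (φ (ε / 2)) = 0 := (mul_eq_zero.1 h4).resolve_left hC0.ne'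
    have h6 : Real.cos (φ (ε / 2)) = 0 := by
      have h7 : -(C * r / l.α) ≠ 0 := neg_ne_zero.2 (div_ne_zero (mul_pos hC0 hr).ne' hα')
      exact (mul_eq_zero.1 ((mul_eq_zero.1 h1).resolve_left h7)).resolve_right
        (delta_pos hm _).ne'
    have h7 := Real.sin_sq_add_cos_sq (φ (ε / 2))
    rw [h5, h6] at h7
    norm_num at h7

theorem eqOn_Icc_of_hasDerivWithinAt {f g d : ℝ → ℝ} {T : ℝ}
    (hf : ∀ t ∈ Icc 0 T, HasDerivWithinAt f (d t) (Icc 0 T) t)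
    (hg : ∀ t ∈ Icc 0 T, HasDerivWithinAt g (d t) (Icc 0 T) t) (h : f 0 = g 0) :
    EqOn f g (Icc 0 T) := by
  intro t ht
  have := constant_of_derivWithin_zero (f := fun s => f s - g s)
    (fun s hs => ((hf s hs).sub (hg s hs)).differentiableWithinAt) (fun s hs => by
      have h' := (hf s (Ico_subset_Icc_self hs)).sub (hg s (Ico_subset_Icc_self hs))
      rw [sub_self] at h'
      exact h'.derivWithin (uniqueDiffOn_Icc (hs.1.trans_lt hs.2) s (Ico_subset_Icc_self hs))) t ht
  linarith

/-- The extremal is the horizontal lift of its projection to the plane. -/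
theorem IsNormalExtremal.eqOn_lift {l : Covector} {T : ℝ} {q ξ : ℝ → Vec4}
    (hn : IsNormalExtremal l T q ξ) {f h₁ h₂ : ℝ → ℝ} (hf : ∀ t, HasDerivAt f (-h₁ t) t)
    (hfc : Continuous f) (hc₂ : Continuous h₂) (hf0 : ∀ t ∈ Icc 0 T, q t 0 = f t)
    (e₁ : ∀ t ∈ Icc 0 T, ξ t ⬝ᵥ X1 (q t) = h₁ t) (e₂ : ∀ t ∈ Icc 0 T, ξ t ⬝ᵥ X2 (q t) = h₂ t)
    (h00 : f 0 = 0) : EqOn q (lift f h₂) (Icc 0 T) := by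
  have hq : ∀ i, ∀ t ∈ Icc 0 T, HasDerivWithinAt (fun s => q s i)
      (-h₁ t * X1 (q t) i + h₂ t * X2 (q t) i) (Icc 0 T) t := fun i t ht => by
    have := hn.hasDerivWithinAt_q ht i
    rwa [e₁ t ht, e₂ t ht] at this
  have hl : ∀ i, ∀ t, HasDerivWithinAt (fun s => lift f h₂ s i)
      (-h₁ t * X1 (lift f h₂ t) i + h₂ t * X2 (lift f h₂ t) i) (Icc 0 T) t := fun i t => by
    have := (hasDerivAt_pi.1 (hasDerivAt_lift hfc hc₂ (hf t)) i).hasDerivWithinAt (s := Icc 0 T)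
    simpa using this
  have hinit : ∀ i, q 0 i = lift f h₂ 0 i := fun i => by
    rw [hn.init_q]
    fin_cases i <;> simp [lift, h00]
  have c1 : EqOn (fun s => q s 1) (fun s => lift f h₂ s 1) (Icc 0 T) :=
    eqOn_Icc_of_hasDerivWithinAt (d := h₂) (fun t ht => (hq 1 t ht).congr_deriv (by simp [X1, X2]))
      (fun t _ => (hl 1 t).congr_deriv (by simp [X1, X2])) (hinit 1)
  have hX : ∀ i, ∀ t ∈ Icc 0 T, -h₁ t * X1 (q t) i + h₂ t * X2 (q t) i =
      -h₁ t * X1 (lift f h₂ t) i + h₂ t * X2 (lift f h₂ t) i := fun i t ht => by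
    have a0 : q t 0 = lift f h₂ t 0 := hf0 t ht
    have a1 : q t 1 = lift f h₂ t 1 := c1 ht
    simp only [X1, X2, a0, a1]
  intro t ht
  funext i
  exact eqOn_Icc_of_hasDerivWithinAt (fun t ht => by rw [← hX i t ht]; exact hq i t ht)
    (fun t _ => hl i t) (hinit i) ht

theorem cutTime_le_of_mem_C1 {l : Covector} (hl : l ∈ C1) :
    cutTime l ≤ ENNReal.ofReal (4 * ellipticK l.m1 / l.ae1) := by
  obtain ⟨h₁, h₂, h₃, hd₁, hd₂, hd₃, i₁, i₂, i₃, p₁, p₂, p₃, hH, hpos, hne⟩ :=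
    exists_periodic_vertical hl
  have hP : 0 < 4 * ellipticK l.m1 / l.ae1 :=
    div_pos (mul_pos four_pos (ellipticK_pos (Covector.m1_lt_one hl))) (Covector.ae1_pos hl)
  generalize 4 * ellipticK l.m1 / l.ae1 = P at *
  have hα : l.α ≠ 0 := hl.1.ne
  have c₁ : Continuous h₁ := continuous_iff_continuousAt.2 fun t => (hd₁ t).continuousAt
  have c₂ : Continuous h₂ := continuous_iff_continuousAt.2 fun t => (hd₂ t).continuousAt
  have c₃ : Continuous h₃ := continuous_iff_continuousAt.2 fun t => (hd₃ t).continuousAt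
  refine cutTime_le_of_forall fun T q ξ hT hn ho => ?_
  by_contra! hPT
  obtain ⟨a, ⟨ha0, haT⟩, ha⟩ := hne (T - P) (by linarith)
  obtain ⟨a', ⟨ha'0, ha'a⟩, ha'⟩ := hne a ha0
  set b := a + P with hb
  have hab : a < b := by linarith
  have hbT : b < T := by linarith
  set f : ℝ → ℝ := fun t => (h₃ t - l.c) / l.α with hf
  have hdf : ∀ t, HasDerivAt f (-h₁ t) t := fun t =>
    (((hd₃ t).sub_const l.c).div_const l.α).congr_deriv (by field_simp)
  have hfc : Continuous f := by fun_prop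
  have hf3 : ∀ t, h₃ t = l.c + l.α * f t := fun t => by simp only [hf]; field_simp; ring
  have hv : IsVertical l.α T h₁ h₂ h₃ := ⟨fun t _ => (hd₁ t).hasDerivWithinAt,
    fun t _ => (hd₂ t).hasDerivWithinAt, fun t _ => (hd₃ t).hasDerivWithinAt⟩
  obtain ⟨j₁, j₂, j₃⟩ := hn.dotProduct_init
  have heq := fun t ht => hn.isVertical.eqOn hv (j₁.trans i₁.symm) (j₂.trans i₂.symm)
    (j₃.trans i₃.symm) (t := t) ht
  have hf0 : f 0 = 0 := by simp [hf, i₃]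
  have hq : EqOn q (lift f h₂) (Icc 0 T) := hn.eqOn_lift hdf hfc c₂
    (fun t ht => by
      have := (heq t ht).2.2
      rw [hf3] at this
      exact mul_left_cancel₀ hα (by linarith))
    (fun t ht => (heq t ht).1) (fun t ht => (heq t ht).2.1) hf0
  have hlen : length T q = T := by
    rw [length_congr hT.le hq, length_lift hfc c₂ hT.le countable_empty (fun t _ => hdf t)
      (fun t _ => by linarith [hH t, neg_sq (h₁ t)])]
    simp [hH]
  have fab : f a = f b := by simp only [hf, hb, p₃]
  set G := reverseOn a b f with hG
  set w := reverseOn a b h₂ with hw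
  set v := reverseOnDeriv a b (fun t => -h₁ t) with hvdef
  have hGc : Continuous G := continuous_reverseOn hab.le fab hfc
  have hwc : Continuous w := continuous_reverseOn hab.le (p₂ a).symm c₂
  have hw0 : ∀ t, 0 < w t := fun t => by
    simp only [hw, reverseOn]; split_ifs <;> exact hpos _
  have hwv : ∀ t, w t ^ 2 - v t ^ 2 = 1 := fun t => by
    simp only [hvdef, hw, reverseOnDeriv_sq, reverseOn]
    split_ifs <;> rw [neg_sq] <;> exact hH _
  have hGne : ∃ s ∈ Ioo 0 a, ∃ t ∈ Ioo 0 a, G s ≠ G t := by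
    by_contra! h
    have h0 : HasDerivAt f 0 a' := by
      refine (hasDerivAt_const a' (f a')).congr_of_eventuallyEq
        (Filter.eventuallyEq_of_mem (isOpen_Ioo.mem_nhds ⟨ha'0, ha'a⟩) fun t ht => ?_)
      have := h t ht a' ⟨ha'0, ha'a⟩
      rwa [hG, reverseOn_of_lt f ht.2, reverseOn_of_lt f ha'a] at this
    exact ha' (neg_eq_zero.1 ((hdf a').unique h0))
  obtain ⟨φ, sφ, φ0, φT, φab, φ1, φ2⟩ :=
    exists_testFunction ha0 hab hbT hGc hwc hw0 hGne (h₁ a) 0 0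
  obtain ⟨ψ, sψ, ψ0, ψT, -, ψ1, ψ2⟩ :=
    exists_testFunction ha0 hab hbT hGc hwc hw0 hGne 0 0 1
  have dφ : ∀ t, HasDerivAt φ (deriv φ t) t := fun t =>
    ((sφ.differentiable one_ne_zero) t).hasDerivAt
  have dψ : ∀ t, HasDerivAt ψ (deriv ψ t) t := fun t =>
    ((sψ.differentiable one_ne_zero) t).hasDerivAt
  have cφ' : Continuous (deriv φ) := sφ.continuous_deriv le_rfl
  have cψ' : Continuous (deriv ψ) := sψ.continuous_deriv le_rfl
  have hvar : ∫ t in (0 : ℝ)..T, v t * deriv φ t < 0 := by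
    have h := integral_reverseOnDeriv_mul_deriv ha0.le hab.le hbT.le (g := fun t => -h₁ t)
      (g' := fun t => h₂ t * h₃ t) (fun t => (hd₁ t).fun_neg.congr_deriv (neg_neg _)) (by fun_prop)
      dφ cφ' φ0 φT (by rw [hb, p₁]) (by rw [hb, p₂, p₃])
    have h' : ∫ t in (0 : ℝ)..T, reverseOn a b (fun t => h₂ t * h₃ t) t * φ t = 0 := by
      have e : ∀ t, reverseOn a b (fun t => h₂ t * h₃ t) t * φ t =
          l.c * (φ t * w t) + l.α * (φ t * (G t * w t)) := fun t => by
        simp only [hG, hw, reverseOn, hf3]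
        split_ifs <;> ring
      simp only [e]
      have := sφ.continuous
      rw [intervalIntegral.integral_add (Continuous.intervalIntegrable (by fun_prop) _ _)
        (Continuous.intervalIntegrable (by fun_prop) _ _), intervalIntegral.integral_const_mul,
        intervalIntegral.integral_const_mul, φ1, φ2]
      ring
    rw [h, h', φab]
    have : 0 < h₁ a ^ 2 := by positivity
    linarith
  obtain ⟨M₁, hM₁⟩ := exists_bound_reverseOnDeriv (S := T) (f' := fun t => -h₁ t) ha0.le hbT.le
    (by fun_prop)
  obtain ⟨M₂, hM₂⟩ := isCompact_Icc.exists_bound_of_continuousOn (s := Icc 0 T) cφ'.continuousOn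
  obtain ⟨M₃, hM₃⟩ := isCompact_Icc.exists_bound_of_continuousOn (s := Icc 0 T) cψ'.continuousOn
  obtain ⟨x, y, k1, k2, k3, k4⟩ := exists_longer_of_first_variation (M := max M₁ (max M₂ M₃)) hT
    hGc hwc sφ.continuous sψ.continuous
    (intervalIntegrable_reverseOnDeriv ha0.le hbT.le hT.le (by fun_prop)) cφ' cψ' hwv
    (fun t ht => (hM₁ t ht).trans (le_max_left _ _))
    (fun t ht => (hM₂ t ht).trans ((le_max_left _ _).trans (le_max_right _ _)))
    (fun t ht => (hM₃ t ht).trans ((le_max_right _ _).trans (le_max_right _ _)))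
    φ1 φ2 ψ1 ψ2 hvar
  set N : ℝ → ℝ := fun t => G t + (x * φ t + y * ψ t) with hN
  have hNc : Continuous N := by
    have := sφ.continuous
    have := sψ.continuous
    fun_prop
  have hNd : ∀ t, t ∉ ({a, b} : Set ℝ) →
      HasDerivAt N (v t + (x * deriv φ t + y * deriv ψ t)) t := fun t ht => by
    rw [mem_insert_iff, mem_singleton_iff, not_or] at ht
    exact (hasDerivAt_reverseOn hdf ht.1 ht.2).add
      (((dφ t).const_mul x).add ((dψ t).const_mul y))
  have hNac : AbsolutelyContinuousOnInterval N 0 T := by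
    have sf : ContDiff ℝ 1 f := contDiff_one_iff_deriv.2 ⟨fun t => (hdf t).differentiableAt, by
      rw [funext fun t => (hdf t).deriv]; fun_prop⟩
    obtain ⟨K, hK⟩ := sf.locallyLipschitz.locallyLipschitzOn.exists_lipschitzOnWith_of_compact
      (isCompact_Icc (a := 0) (b := T))
    have h1 := lipschitzOnWith_reverseOn ha0.le hab.le hbT.le fab hK
    rw [← uIcc_of_le hT.le] at h1
    exact h1.absolutelyContinuousOnInterval.add (ContDiff.contDiffOn
      (by fun_prop)).absolutelyContinuousOnInterval
  have hcount : ({a, b} : Set ℝ).Countable := (countable_singleton b).insert a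
  have hspace : IsSpacelikeFD T (lift N w) := isSpacelikeFD_lift hNc hwc hNac hcount hNd k3 hw0
  have hlonger : length T q < length T (lift N w) := by
    rw [hlen, length_lift hNc hwc hT.le hcount hNd k3]
    exact k4
  have N0 : N 0 = f 0 := by
    simp only [hN, φ0, ψ0, hG, reverseOn_of_lt f ha0]; ring
  have NT : N T = f T := by
    simp only [hN, φT, ψT, hG, reverseOn_of_gt f hbT]; ring
  have w1 : ∫ t in (0 : ℝ)..T, w t = ∫ t in (0 : ℝ)..T, h₂ t :=
    integral_reverseOn ha0.le hab.le hbT.le (p₂ a).symm c₂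
  have w2 : ∫ t in (0 : ℝ)..T, N t * w t = ∫ t in (0 : ℝ)..T, f t * h₂ t := by
    refine k1.trans ?_
    rw [← integral_reverseOn ha0.le hab.le hbT.le (f := fun t => f t * h₂ t)
      (by rw [fab, hb, p₂]) (by fun_prop)]
    refine intervalIntegral.integral_congr fun t _ => ?_
    simp only [hG, hw, reverseOn]
    split_ifs <;> rfl
  have w3 : ∫ t in (0 : ℝ)..T, N t ^ 2 * w t = ∫ t in (0 : ℝ)..T, f t ^ 2 * h₂ t := by
    refine k2.trans ?_
    rw [← integral_reverseOn ha0.le hab.le hbT.le (f := fun t => f t ^ 2 * h₂ t)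
      (by rw [fab, hb, p₂]) (by fun_prop)]
    refine intervalIntegral.integral_congr fun t _ => ?_
    simp only [hG, hw, reverseOn]
    split_ifs <;> rfl
  refine absurd (ho.2 (lift N w) hspace ?_ ?_) (not_le.2 hlonger)
  · rw [hq ⟨le_rfl, hT.le⟩]
    simp [lift, N0]
  · rw [hq ⟨hT.le, le_rfl⟩]
    simp only [lift, NT, w1, w2, w3]

end Engel

end

theorem mainTheorem2 :
    (∀ l ∈ Engel.C1,
      Engel.cutTime l ≤ ENNReal.ofReal (4 * Engel.ellipticK l.m1 / l.ae1)) ∧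
    (∀ l ∈ Engel.C2,
      (∃! φ₀ : ℝ, l.IsPhase2 φ₀) ∧
      ∀ φ₀ : ℝ, l.IsPhase2 φ₀ →
        Engel.cutTime l ≤ ENNReal.ofReal ((Engel.ellipticK l.m2 - l.ae2 * φ₀) / l.ae2)) ∧
    (∀ l ∈ Engel.C3,
      (∃! φ₀ : ℝ, l.IsPhase3 φ₀) ∧
      ∀ φ₀ : ℝ, l.IsPhase3 φ₀ →
        Engel.cutTime l ≤ ENNReal.ofReal ((Engel.ellipticK l.m3 - l.ae3 * φ₀) / l.ae3)) :=
  ⟨fun _ hl => Engel.cutTime_le_of_mem_C1 hl,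
    fun _ hl => ⟨Engel.existsUnique_isPhase2 hl, fun _ h => Engel.cutTime_le_of_isPhase2 hl h⟩,
    fun _ hl => ⟨Engel.existsUnique_isPhase3 hl, fun _ h => Engel.cutTime_le_of_isPhase3 hl h⟩⟩
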